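/- Let $\lambda=(\lambda_n)_n$ be a frequency, i.e. a strictly increasing unbounded sequence of non-negative real numbers, and suppose that $\{\lambda_n\}$ contains arbitrarily long arithmetic progressions: for every $N$ there are $a\in\mathbb R$, $d>0$ with $a+kd\in\{\lambda_n\}$ for $k=0,\dots,N-1$. Let $1\le p\le\infty$. For a $\lambda$-Dirichlet polynomial $D=\sum_{n\in A}a_ne^{-\lambda_ns}$ ($A$ finite, $a_n\in\mathbb C$) put $$\|D\|_p=\lim_{R\to\infty}\Big(\frac1{2R}\int_{-R}^R\Big|\sum_{n\in A}a_ne^{-i\lambda_nt}\Big|^p\,dt\Big)^{1/p}\quad(p<\infty),\qquad \|D\|_\infty=\sup_{t\in\mathbb R}\Big|\sum_{n\in A}a_ne^{-i\lambda_nt}\Big| ,$$ and let $\mathbb X=\mathcal H_p^\lambda$ be the completion of the space of $\lambda$-Dirichlet polynomials in this norm (for $p=\infty$ this completion is usually denoted $\mathcal A_\infty^\lambda$). Let $\mathcal B=(\mathbf x_n)$, $\mathbf x_n=e^{-\lambda_ns}$, be its canonical basis and $(\mathbf x_n^*)$ the dual basis, given by the continuous extensions of the coefficient functionals. For a finite set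 $A$ of indices let $P_A(f)=\sum_{n\in A}\mathbf x_n^*(f)\mathbf x_n$; call $A$ a greedy set of $f$ if $|\mathbf x_j^*(f)|\ge|\mathbf x_k^*(f)|$ for all $j\in A$, $k\notin A$. Then each one of the following seven properties holds if and only if $p=2$. In all of them $f$ ranges over $\mathbb X$ and $A,B$ range over finite sets of indices. 1. $\mathcal B$ is greedy: there is $C$ such that $\|f-P_A(f)\|\le C\|f-\sum_{n\in B}b_n\mathbf x_n\|$ for all $f$, all greedy sets $A$ of $f$, all $B$ with $|B|\le|A|$ and all scalars $b_n$. 2. $\mathcal B$ is almost greedy: there is $C$ such that $\|f-P_A(f)\|\le C\|f-P_B(f)\|$ for all $f$, all greedy sets $A$ of $f$ and all $B$ with $|B|\le|A|$. 3. $\mathcal B$ is semi-greedy: there is $C$ such that for all $f$ and all greedy sets $A$ of $f$ there is a best approximation $g$ to $f$ from $\operatorname{span}\{\mathbf x_n:n\in A\}$ with $\|f-g\|\le C\|f-\sum_{n\in B}b_n\mathbf x_n\|$ for all $B$ with $|B|\le|A|$ and all scalars $b_n$. 4. $\mathcal B$ is quasi-greedy: there is $C$ such that $\|P_A(f)\|\le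 C\|f\|$ for all $f$ and all greedy sets $A$ of $f$. 5. $\mathcal B$ is nearly unconditional: for every $\tau\in(0,1]$ there is $C$ such that $\|P_A(f)\|\le C\|f\|$ whenever $\sup_n|\mathbf x_n^*(f)|\le1$ and $|\mathbf x_n^*(f)|\ge\tau$ for all $n\in A$. 6. $\mathcal B$ is quasi-greedy for largest coefficients: there is $C$ such that $\|\sum_{n\in A}\varepsilon_n\mathbf x_n\|\le C\|\sum_{n\in A}\varepsilon_n\mathbf x_n+f\|$ for all $A$, all scalars $|\varepsilon_n|=1$ ($n\in A$), and all $f$ with $\sup_n|\mathbf x_n^*(f)|\le1$ and $\mathbf x_n^*(f)=0$ for $n\in A$. 7. $\mathcal B$ is SUCC (suppression unconditional for constant coefficients): there is $C$ such that $\|\sum_{n\in A}\varepsilon_n\mathbf x_n\|\le C\|\sum_{n\in B}\delta_n\mathbf x_n\|$ for all $A\subset B$ and all scalars $|\varepsilon_n|=1$ ($n\in A$), $|\delta_n|=1$ ($n\in B$). -/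

import Mathlib

open Filter Topology MeasureTheory
open scoped ENNReal

noncomputable section

/-! ### Frequencies and Dirichlet polynomials -/

/-- A frequency: a strictly increasing unbounded sequence of non-negative real numbers. -/
structure Frequency where
  /-- the sequence -/
  seq : ℕ → ℝ
  strictMono : StrictMono seq
  nonneg : ∀ n, 0 ≤ seq n
  unbounded : Tendsto seq atTop atTop

/-- The terms of the frequency contain non-constant arithmetic progressions of every finite
length. -/
def Frequency.HasLongAPs (lam : Frequency) : Prop :=
  ∀ N : ℕ, ∃ a d : ℝ, 0 < d ∧ ∀ k : ℕ, k < N → a + k * d ∈ Set.range lam.seq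

/-- The space of `λ`-Dirichlet polynomials `∑ aₙ e^{-λₙ s}`, given by their finitely supported
coefficient sequences; the parameter `p` records which norm the space will carry. -/
def DirichletPoly (_lam : Frequency) (_p : ℝ≥0∞) : Type := ℕ →₀ ℂ

namespace DirichletPoly

variable {lam : Frequency} {p : ℝ≥0∞}

instance : AddCommGroup (DirichletPoly lam p) := inferInstanceAs (AddCommGroup (ℕ →₀ ℂ))

instance : Module ℂ (DirichletPoly lam p) := inferInstanceAs (Module ℂ (ℕ →₀ ℂ))

/-- The `n`-th coefficient of a Dirichlet polynomial. -/
def coeffₗ (lam : Frequency) (p : ℝ≥0∞) (n : ℕ) : DirichletPoly lam p →ₗ[ℂ] ℂ :=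
  Finsupp.lapply n

/-- The monomial `e^{-λₙ s}`. -/
def monomial (lam : Frequency) (p : ℝ≥0∞) (n : ℕ) : DirichletPoly lam p :=
  Finsupp.single n (1 : ℂ)

/-- The value `∑ aₙ e^{-i λₙ t}` of a Dirichlet polynomial at the point `s = i t`. -/
def evalIm (D : DirichletPoly lam p) (t : ℝ) : ℂ :=
  Finsupp.sum (show ℕ →₀ ℂ from D)
    fun n a => a * Complex.exp (-(lam.seq n * t * Complex.I))

/-- The `p`-th mean of a Dirichlet polynomial on the segment `[-iR, iR]`. -/
def pMean (D : DirichletPoly lam p) (R : ℝ) : ℝ :=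
  (1 / (2 * R) * ∫ t in (-R)..R, ‖evalIm D t‖ ^ p.toReal) ^ (1 / p.toReal)

/-- The norm of a Dirichlet polynomial: the limit of the `p`-th means for finite `p`, and the
supremum on the imaginary axis for `p = ∞`. -/
instance : Norm (DirichletPoly lam p) where
  norm D := if p = ∞ then ⨆ t : ℝ, ‖evalIm D t‖ else limUnder atTop (pMean D)

theorem norm_def (D : DirichletPoly lam p) :
    ‖D‖ = if p = ∞ then ⨆ t : ℝ, ‖evalIm D t‖ else limUnder atTop (pMean D) := rfl

/-! ### The limit exists and defines a norm -/

theorem ext' {D E : DirichletPoly lam p} (h : ∀ n, coeffₗ lam p n D = coeffₗ lam p n E) :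
    D = E := Finsupp.ext h

theorem evalIm_add (D E : DirichletPoly lam p) (t : ℝ) :
    evalIm (D + E) t = evalIm D t + evalIm E t :=
  Finsupp.sum_add_index' (by simp) (by intros; ring)

theorem evalIm_smul (c : ℂ) (D : DirichletPoly lam p) (t : ℝ) :
    evalIm (c • D) t = c * evalIm D t := by
  unfold evalIm
  refine (Finsupp.sum_smul_index (by simp)).trans ?_
  rw [Finsupp.mul_sum]
  simp [mul_assoc]

theorem continuous_evalIm (D : DirichletPoly lam p) : Continuous (evalIm D) := by
  unfold evalIm Finsupp.sum
  fun_prop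

theorem exists_bound (D : DirichletPoly lam p) : ∃ B : ℝ, ∀ t, ‖evalIm D t‖ ≤ B := by
  refine ⟨∑ n ∈ Finsupp.support (show ℕ →₀ ℂ from D), ‖(show ℕ →₀ ℂ from D) n‖, fun t => ?_⟩
  refine (norm_sum_le _ _).trans (Finset.sum_le_sum fun n _ => ?_)
  rw [norm_mul]
  have : ‖Complex.exp (-(lam.seq n * t * Complex.I))‖ = 1 := by
    have := Complex.norm_exp_ofReal_mul_I (-(lam.seq n * t))
    push_cast at this
    rwa [neg_mul] at this
  rw [this, mul_one]

/-- The function `t ↦ e^{iθt}`, as a homomorphism in `θ`. -/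
def expHom : Multiplicative ℝ →* (ℝ → ℂ) where
  toFun θ t := Complex.exp ((Multiplicative.toAdd θ : ℝ) * t * Complex.I)
  map_one' := by ext; simp
  map_mul' a b := by
    ext t
    simp [← Complex.exp_add, add_mul]

/-- The function `h` is continuous and its means over `[-R, R]` converge to `m`. -/
def HasMean (h : ℝ → ℂ) (m : ℂ) : Prop :=
  Continuous h ∧ Tendsto (fun R : ℝ => ((1 / (2 * R) : ℝ) : ℂ) * ∫ t in (-R)..R, h t) atTop (𝓝 m)

theorem HasMean.add {h g : ℝ → ℂ} {m k : ℂ} (H : HasMean h m) (G : HasMean g k) :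
    HasMean (h + g) (m + k) := by
  refine ⟨H.1.add G.1, (H.2.add G.2).congr fun R => ?_⟩
  rw [← mul_add, ← intervalIntegral.integral_add (H.1.intervalIntegrable _ _)
    (G.1.intervalIntegrable _ _)]
  rfl

theorem HasMean.smul {h : ℝ → ℂ} {m : ℂ} (c : ℂ) (H : HasMean h m) :
    HasMean (c • h) (c * m) := by
  refine ⟨H.1.const_smul c, (H.2.const_mul c).congr fun R => ?_⟩
  simp only [Pi.smul_apply, smul_eq_mul, intervalIntegral.integral_const_mul]
  ring

theorem hasMean_expHom (θ : ℝ) :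
    HasMean (expHom (Multiplicative.ofAdd θ)) (if θ = 0 then 1 else 0) := by
  refine ⟨by simp only [expHom]; dsimp; fun_prop, ?_⟩
  split_ifs with h
  · subst h
    refine tendsto_const_nhds.congr' ?_
    filter_upwards [eventually_gt_atTop 0] with R hR
    have : (R : ℂ) ≠ 0 := by exact_mod_cast hR.ne'
    simp [expHom]
    field_simp
    ring
  · have hc : (θ : ℂ) * Complex.I ≠ 0 := by simp [h]
    have key : ∀ R : ℝ, (∫ t in (-R)..R, expHom (Multiplicative.ofAdd θ) t)
        = (Complex.exp (θ * Complex.I * R) - Complex.exp (θ * Complex.I * (-R : ℝ)))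
          / (θ * Complex.I) := by
      intro R
      rw [← integral_exp_mul_complex hc]
      refine intervalIntegral.integral_congr fun t _ => ?_
      simp only [expHom, MonoidHom.coe_mk, OneHom.coe_mk, toAdd_ofAdd]
      ring_nf
    have hn : ∀ x : ℝ, ‖Complex.exp (θ * Complex.I * x)‖ = 1 := fun x => by
      have := Complex.norm_exp_ofReal_mul_I (θ * x)
      push_cast at this
      rwa [mul_right_comm] at this
    refine squeeze_zero_norm' (a := fun R : ℝ => (1 / (2 * R)) * (2 / |θ|)) ?_ ?_
    · filter_upwards [eventually_gt_atTop 0] with R hR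
      rw [key, norm_mul, norm_div, Complex.norm_real, Real.norm_of_nonneg (by positivity)]
      gcongr
      · refine (norm_sub_le _ _).trans ?_
        rw [hn, hn]; norm_num
      · simp
    · rw [← zero_mul (2 / |θ|)]
      refine Tendsto.mul_const _ ?_
      simp only [one_div]
      exact tendsto_inv_atTop_zero.comp (tendsto_id.const_mul_atTop (by norm_num))

/-- The algebra of trigonometric polynomials with real frequencies. -/
def trigAlg : Subalgebra ℂ (ℝ → ℂ) := Algebra.adjoin ℂ (MonoidHom.mrange expHom : Set (ℝ → ℂ))

theorem exists_hasMean {h : ℝ → ℂ} (hh : h ∈ trigAlg) : ∃ m, HasMean h m := by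
  have hh' : h ∈ Submodule.span ℂ (MonoidHom.mrange expHom : Set (ℝ → ℂ)) := by
    have := (Subalgebra.mem_toSubmodule trigAlg).2 hh
    rwa [trigAlg, Algebra.adjoin_eq_span, Submonoid.closure_eq] at this
  induction hh' using Submodule.span_induction with
  | mem x hx =>
    obtain ⟨θ, rfl⟩ := hx
    exact ⟨_, hasMean_expHom (Multiplicative.toAdd θ)⟩
  | zero => exact ⟨0, continuous_zero, by simp⟩
  | add x y hx hy ihx ihy =>
    have mem : ∀ z ∈ Submodule.span ℂ (MonoidHom.mrange expHom : Set (ℝ → ℂ)), z ∈ trigAlg := by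
      intro z hz
      rw [← Subalgebra.mem_toSubmodule, trigAlg, Algebra.adjoin_eq_span, Submonoid.closure_eq]
      exact hz
    obtain ⟨m, hm⟩ := ihx (mem x hx)
    obtain ⟨k, hk⟩ := ihy (mem y hy)
    exact ⟨_, hm.add hk⟩
  | smul c x hx ih =>
    have mem : ∀ z ∈ Submodule.span ℂ (MonoidHom.mrange expHom : Set (ℝ → ℂ)), z ∈ trigAlg := by
      intro z hz
      rw [← Subalgebra.mem_toSubmodule, trigAlg, Algebra.adjoin_eq_span, Submonoid.closure_eq]
      exact hz
    obtain ⟨m, hm⟩ := ih (mem x hx)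
    exact ⟨_, hm.smul c⟩

theorem expHom_mem (θ : ℝ) : expHom (Multiplicative.ofAdd θ) ∈ trigAlg :=
  Algebra.subset_adjoin ⟨_, rfl⟩

theorem evalIm_mem (D : DirichletPoly lam p) : evalIm D ∈ trigAlg := by
  have : evalIm D = ∑ n ∈ Finsupp.support (show ℕ →₀ ℂ from D),
      (show ℕ →₀ ℂ from D) n • expHom (Multiplicative.ofAdd (-lam.seq n)) := by
    ext t
    simp [evalIm, Finsupp.sum, expHom]
  rw [this]
  exact Subalgebra.sum_mem _ fun n _ => Subalgebra.smul_mem _ (expHom_mem _) _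

theorem conj_evalIm_mem (D : DirichletPoly lam p) : star (evalIm D) ∈ trigAlg := by
  have : star (evalIm D) = ∑ n ∈ Finsupp.support (show ℕ →₀ ℂ from D),
      star ((show ℕ →₀ ℂ from D) n) • expHom (Multiplicative.ofAdd (lam.seq n)) := by
    ext t
    simp [evalIm, Finsupp.sum, expHom, ← Complex.exp_conj]
  rw [this]
  exact Subalgebra.sum_mem _ fun n _ => Subalgebra.smul_mem _ (expHom_mem _) _

theorem poly_normSq_mem (D : DirichletPoly lam p) (P : Polynomial ℝ) :
    (fun t => ((P.eval (‖evalIm D t‖ ^ 2) : ℝ) : ℂ)) ∈ trigAlg := by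
  have h1 : evalIm D * star (evalIm D) ∈ trigAlg :=
    Subalgebra.mul_mem _ (evalIm_mem D) (conj_evalIm_mem D)
  have h2 : Polynomial.aeval (evalIm D * star (evalIm D)) (P.map Complex.ofRealHom) ∈ trigAlg :=
    (Algebra.adjoin_le (Set.singleton_subset_iff.2 h1))
      (Polynomial.aeval_mem_adjoin_singleton ℂ _)
  convert h2 using 1
  ext t
  have h3 := Polynomial.aeval_algHom_apply (Pi.evalAlgHom ℂ (fun _ : ℝ => ℂ) t)
    (evalIm D * star (evalIm D)) (P.map Complex.ofRealHom)
  simp only [Pi.evalAlgHom_apply] at h3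
  rw [← h3]
  have h4 : (evalIm D * star (evalIm D)) t = Complex.ofRealHom (‖evalIm D t‖ ^ 2) := by
    simp [Complex.mul_conj, Complex.normSq_eq_norm_sq]
  rw [h4, Polynomial.coe_aeval_eq_eval, Polynomial.eval_map, Polynomial.eval₂_hom]
  rfl

theorem exists_tendsto_mean (D : DirichletPoly lam p) {q : ℝ} (hq : 0 ≤ q) :
    ∃ m : ℝ, Tendsto (fun R : ℝ => 1 / (2 * R) * ∫ t in (-R)..R, ‖evalIm D t‖ ^ q)
      atTop (𝓝 m) := by
  obtain ⟨B, hB⟩ := exists_bound D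
  have hcont : Continuous fun t => ‖evalIm D t‖ ^ q :=
    (continuous_evalIm D).norm.rpow_const fun _ => Or.inr hq
  refine cauchySeq_tendsto_of_complete (Metric.cauchySeq_iff'.2 fun ε hε => ?_)
  obtain ⟨P, hP⟩ := exists_polynomial_near_of_continuousOn 0 (B ^ 2) (fun u => u ^ (q / 2))
    (Real.continuous_rpow_const (by positivity)).continuousOn (ε / 4) (by positivity)
  obtain ⟨m, hPc, hm⟩ := exists_hasMean (poly_normSq_mem D P)
  have hPc' : Continuous fun t => P.eval (‖evalIm D t‖ ^ 2) :=
    P.continuous.comp ((continuous_evalIm D).norm.pow 2)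
  have hm' : Tendsto (fun R : ℝ => 1 / (2 * R) * ∫ t in (-R)..R, P.eval (‖evalIm D t‖ ^ 2))
      atTop (𝓝 m.re) := by
    refine ((Complex.continuous_re.tendsto m).comp hm).congr fun R => ?_
    simp only [Function.comp]
    rw [intervalIntegral.integral_ofReal, ← Complex.ofReal_mul, Complex.ofReal_re]
  have close : ∀ R : ℝ, 0 < R → |(1 / (2 * R) * ∫ t in (-R)..R, ‖evalIm D t‖ ^ q)
      - 1 / (2 * R) * ∫ t in (-R)..R, P.eval (‖evalIm D t‖ ^ 2)| ≤ ε / 4 := by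
    intro R hR
    rw [← mul_sub, ← intervalIntegral.integral_sub (hcont.intervalIntegrable _ _)
      (hPc'.intervalIntegrable _ _), abs_mul, abs_of_pos (by positivity)]
    have : ‖∫ t in (-R)..R, (‖evalIm D t‖ ^ q - P.eval (‖evalIm D t‖ ^ 2))‖
        ≤ ε / 4 * |R - -R| := by
      refine intervalIntegral.norm_integral_le_of_norm_le_const fun t _ => ?_
      have h := hP (‖evalIm D t‖ ^ 2) ⟨by positivity, by gcongr; exact hB t⟩
      have e : (‖evalIm D t‖ ^ 2) ^ (q / 2) = ‖evalIm D t‖ ^ q := by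
        rw [← Real.rpow_natCast, ← Real.rpow_mul (norm_nonneg _)]
        congr 1; push_cast; ring
      simp only [e] at h
      rw [Real.norm_eq_abs, abs_sub_comm]
      exact h.le
    calc _ ≤ 1 / (2 * R) * (ε / 4 * |R - -R|) := by gcongr; exact this
      _ = ε / 4 := by
        rw [abs_of_pos (by linarith)]; field_simp; ring
  obtain ⟨N', hN'⟩ := (eventually_atTop.1
    ((hm'.eventually (Metric.ball_mem_nhds m.re (show 0 < ε / 8 by positivity))).and
      (eventually_gt_atTop (0 : ℝ))))
  refine ⟨N', fun R hR => ?_⟩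
  have a1 := close R (hN' R hR).2
  have a2 := close N' (hN' N' le_rfl).2
  have a3 := (hN' R hR).1
  have a4 := (hN' N' le_rfl).1
  rw [Real.dist_eq] at a3 a4 ⊢
  rw [abs_le] at a1 a2
  rw [abs_lt] at a3 a4 ⊢
  constructor <;> linarith [a1.1, a1.2, a2.1, a2.2, a3.1, a3.2, a4.1, a4.2]

/-- For finite `p` the limit in the definition of the norm exists. -/
theorem tendsto_pMean (hp : p ≠ ∞) (D : DirichletPoly lam p) :
    Tendsto (pMean D) atTop (𝓝 ‖D‖) := by
  rw [norm_def, if_neg hp]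
  obtain ⟨m, hm⟩ := exists_tendsto_mean D (q := p.toReal) ENNReal.toReal_nonneg
  exact tendsto_nhds_limUnder
    ⟨_, hm.rpow_const (Or.inr (one_div_nonneg.2 ENNReal.toReal_nonneg))⟩

/-- Normalised Lebesgue measure on `[-R, R]`. -/
def segMeasure (R : ℝ) : Measure ℝ :=
  ENNReal.ofReal (1 / (2 * R)) • volume.restrict (Set.Ioc (-R) R)

theorem isProb_segMeasure {R : ℝ} (hR : 0 < R) : IsProbabilityMeasure (segMeasure R) := by
  refine ⟨?_⟩
  rw [segMeasure, Measure.smul_apply, Measure.restrict_apply MeasurableSet.univ, Set.univ_inter,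
    Real.volume_Ioc, smul_eq_mul, ← ENNReal.ofReal_mul (by positivity), ← ENNReal.ofReal_one]
  congr 1
  field_simp
  ring

theorem memLp_evalIm {R : ℝ} (hR : 0 < R) (q : ℝ≥0∞) (D : DirichletPoly lam p) :
    MemLp (evalIm D) q (segMeasure R) := by
  have := isProb_segMeasure hR
  obtain ⟨B, hB⟩ := exists_bound D
  exact MemLp.of_bound (continuous_evalIm D).aestronglyMeasurable B (Eventually.of_forall hB)

theorem integral_segMeasure {E : Type*} [NormedAddCommGroup E] [NormedSpace ℝ E]
    {R : ℝ} (hR : 0 < R) (f : ℝ → E) :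
    ∫ t, f t ∂(segMeasure R) = (1 / (2 * R)) • ∫ t in (-R)..R, f t := by
  rw [segMeasure, integral_smul_measure, intervalIntegral.integral_of_le (by linarith),
    ENNReal.toReal_ofReal (by positivity)]

theorem pMean_eq [Fact (1 ≤ p)] (hp : p ≠ ∞) {R : ℝ} (hR : 0 < R) (D : DirichletPoly lam p) :
    pMean D R = (eLpNorm (evalIm D) p (segMeasure R)).toReal := by
  have h0 : p ≠ 0 := (zero_lt_one.trans_le (Fact.out : 1 ≤ p)).ne'
  rw [MemLp.eLpNorm_eq_integral_rpow_norm h0 hp (memLp_evalIm hR p D), ENNReal.toReal_ofReal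
    (by positivity), integral_segMeasure hR, pMean, one_div p.toReal, smul_eq_mul]

theorem norm_eval_le (hp : p = ∞) (D : DirichletPoly lam p) (t : ℝ) : ‖evalIm D t‖ ≤ ‖D‖ := by
  rw [norm_def, if_pos hp]
  obtain ⟨B, hB⟩ := exists_bound D
  exact le_ciSup (f := fun t => ‖evalIm D t‖) ⟨B, by rintro _ ⟨t, rfl⟩; exact hB t⟩ t

theorem norm_nonneg' (D : DirichletPoly lam p) : 0 ≤ ‖D‖ := by
  by_cases hp : p = ∞
  · exact (norm_nonneg _).trans (norm_eval_le hp D 0)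
  · refine ge_of_tendsto (tendsto_pMean hp D) ?_
    filter_upwards [eventually_gt_atTop 0] with R hR
    unfold pMean
    refine Real.rpow_nonneg (mul_nonneg (by positivity) ?_) _
    exact intervalIntegral.integral_nonneg (by linarith) fun t _ => by positivity

theorem norm_add_le' [Fact (1 ≤ p)] (D E : DirichletPoly lam p) : ‖D + E‖ ≤ ‖D‖ + ‖E‖ := by
  by_cases hp : p = ∞
  · rw [norm_def (D + E), if_pos hp]
    refine ciSup_le fun t => ?_
    rw [evalIm_add]
    exact (norm_add_le _ _).trans (add_le_add (norm_eval_le hp D t) (norm_eval_le hp E t))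
  · refine le_of_tendsto_of_tendsto (tendsto_pMean hp _)
      ((tendsto_pMean hp D).add (tendsto_pMean hp E)) ?_
    filter_upwards [eventually_gt_atTop 0] with R hR
    rw [pMean_eq hp hR, pMean_eq hp hR, pMean_eq hp hR, ← ENNReal.toReal_add
      (memLp_evalIm hR p D).2.ne (memLp_evalIm hR p E).2.ne]
    refine ENNReal.toReal_mono (ENNReal.add_ne_top.2
      ⟨(memLp_evalIm hR p D).2.ne, (memLp_evalIm hR p E).2.ne⟩) ?_
    have : evalIm (D + E) = evalIm D + evalIm E := funext fun t => evalIm_add D E t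
    rw [this]
    exact eLpNorm_add_le (memLp_evalIm hR p D).1 (memLp_evalIm hR p E).1 Fact.out

theorem norm_smul' [Fact (1 ≤ p)] (c : ℂ) (D : DirichletPoly lam p) : ‖c • D‖ = ‖c‖ * ‖D‖ := by
  by_cases hp : p = ∞
  · rw [norm_def, norm_def, if_pos hp, if_pos hp, Real.mul_iSup_of_nonneg (norm_nonneg c)]
    simp [evalIm_smul]
  · refine tendsto_nhds_unique (tendsto_pMean hp (c • D))
      (((tendsto_pMean hp D).const_mul ‖c‖).congr' ?_)
    filter_upwards [eventually_gt_atTop 0] with R hR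
    have : evalIm (c • D) = c • evalIm D := funext fun t => evalIm_smul c D t
    rw [pMean_eq hp hR, pMean_eq hp hR, this, eLpNorm_const_smul]
    simp

/-- The `n`-th coefficient is the mean of `D(it) e^{i λₙ t}`. -/
theorem hasMean_coeff (D : DirichletPoly lam p) (n : ℕ) :
    HasMean (fun t => evalIm D t * expHom (Multiplicative.ofAdd (lam.seq n)) t)
      (coeffₗ lam p n D) := by
  induction D using Finsupp.induction_linear with
  | zero =>
    have e : coeffₗ lam p n (0 : ℕ →₀ ℂ) = 0 := map_zero (coeffₗ lam p n)
    have e' : ∀ t, evalIm (lam := lam) (p := p) (0 : ℕ →₀ ℂ) t = 0 :=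
      fun t => Finsupp.sum_zero_index
    rw [e]
    simp only [e', zero_mul]
    exact ⟨continuous_const, by simp⟩
  | add f g hf hg =>
    have h := HasMean.add (hf) (hg)
    have e : coeffₗ lam p n (f + g) = coeffₗ lam p n f + coeffₗ lam p n g := map_add _ _ _
    rw [e]
    convert h using 1
    ext t
    simp only [Pi.add_apply]
    rw [← add_mul]
    congr 1
    exact evalIm_add (lam := lam) (p := p) f g t
  | single k a =>
    have h := (hasMean_expHom (lam.seq n - lam.seq k)).smul a
    have e : a * (if lam.seq n - lam.seq k = 0 then 1 else 0)
        = coeffₗ lam p n (Finsupp.single k a : ℕ →₀ ℂ) := by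
      change _ = (Finsupp.single k a : ℕ →₀ ℂ) n
      rw [Finsupp.single_apply]
      by_cases hk : k = n
      · simp [hk]
      · have : lam.seq n - lam.seq k ≠ 0 :=
          sub_ne_zero.2 fun h => hk (lam.strictMono.injective h).symm
        simp [hk, this]
    rw [e] at h
    convert h using 1
    ext t
    have : evalIm (lam := lam) (p := p) (Finsupp.single k a : ℕ →₀ ℂ) t
        = a * Complex.exp (-(lam.seq k * t * Complex.I)) :=
      Finsupp.sum_single_index (by simp)
    simp only [this, Pi.smul_apply, smul_eq_mul, expHom, MonoidHom.coe_mk, OneHom.coe_mk,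
      toAdd_ofAdd, mul_assoc, ← Complex.exp_add]
    congr 2
    push_cast
    ring

theorem norm_coeff_le [Fact (1 ≤ p)] (D : DirichletPoly lam p) (n : ℕ) :
    ‖coeffₗ lam p n D‖ ≤ ‖D‖ := by
  have key : ∀ R : ℝ, 0 < R → ‖((1 / (2 * R) : ℝ) : ℂ) * ∫ t in (-R)..R,
      evalIm D t * expHom (Multiplicative.ofAdd (lam.seq n)) t‖
        ≤ (eLpNorm (evalIm D) p (segMeasure R)).toReal := by
    intro R hR
    have := isProb_segMeasure hR
    rw [← Complex.real_smul, ← integral_segMeasure hR]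
    refine (norm_integral_le_integral_norm _).trans ?_
    have e : ∀ t, ‖evalIm D t * expHom (Multiplicative.ofAdd (lam.seq n)) t‖ = ‖evalIm D t‖ := by
      intro t
      have := Complex.norm_exp_ofReal_mul_I (lam.seq n * t)
      push_cast at this
      rw [norm_mul]
      simp [expHom, this]
    simp only [e]
    rw [integral_norm_eq_lintegral_enorm (memLp_evalIm hR 1 D).1, ← eLpNorm_one_eq_lintegral_enorm]
    exact ENNReal.toReal_mono (memLp_evalIm hR p D).2.ne
      (eLpNorm_le_eLpNorm_of_exponent_le Fact.out (memLp_evalIm hR 1 D).1)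
  by_cases hp : p = ∞
  · refine le_of_tendsto (hasMean_coeff D n).2.norm ?_
    filter_upwards [eventually_gt_atTop 0] with R hR
    refine (key R hR).trans ?_
    have := isProb_segMeasure hR
    refine ENNReal.toReal_le_of_le_ofReal (norm_nonneg' D) ?_
    refine (eLpNorm_le_of_ae_bound (C := ‖D‖) (Eventually.of_forall (norm_eval_le hp D))).trans ?_
    simp
  · refine le_of_tendsto_of_tendsto (hasMean_coeff D n).2.norm (tendsto_pMean hp D) ?_
    filter_upwards [eventually_gt_atTop 0] with R hR
    rw [pMean_eq hp hR]
    exact key R hR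

variable [Fact (1 ≤ p)]

theorem normCore : NormedSpace.Core ℂ (DirichletPoly lam p) where
  norm_nonneg := norm_nonneg'
  norm_smul := norm_smul'
  norm_triangle := norm_add_le'
  norm_eq_zero_iff D := by
    constructor
    · intro h
      refine ext' fun n => ?_
      have := norm_coeff_le D n
      rw [h] at this
      rw [norm_le_zero_iff.1 this, map_zero]
    · rintro rfl
      simpa using norm_smul' (0 : ℂ) (0 : DirichletPoly lam p)

instance : NormedAddCommGroup (DirichletPoly lam p) := NormedAddCommGroup.ofCore normCore

instance : NormedSpace ℂ (DirichletPoly lam p) where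
  norm_smul_le c D := (norm_smul' c D).le

/-- The `n`-th coefficient as a bounded functional on Dirichlet polynomials. -/
def coeffL (lam : Frequency) (p : ℝ≥0∞) [Fact (1 ≤ p)] (n : ℕ) : DirichletPoly lam p →L[ℂ] ℂ :=
  (coeffₗ lam p n).mkContinuous 1 fun D => by simpa using norm_coeff_le D n

end DirichletPoly

/-! ### Hardy spaces of general Dirichlet series -/

/-- The completion of the space of `λ`-Dirichlet polynomials in the norm with exponent `p`: the
Hardy space `H_p^λ` for `p < ∞`, and the space `A_∞^λ` for `p = ∞`. -/
abbrev HardySpace (lam : Frequency) (p : ℝ≥0∞) [Fact (1 ≤ p)] : Type :=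
  UniformSpace.Completion (DirichletPoly lam p)

namespace HardySpace

variable (lam : Frequency) (p : ℝ≥0∞) [Fact (1 ≤ p)]

/-- The canonical basis `{e^{-λₙ s}}`. -/
def basis (n : ℕ) : HardySpace lam p := (DirichletPoly.monomial lam p n : HardySpace lam p)

/-- The dual basis: the continuous extensions of the coefficient functionals. -/
def coeff (n : ℕ) : HardySpace lam p →L[ℂ] ℂ :=
  (DirichletPoly.coeffL lam p n).extend (UniformSpace.Completion.toComplL (𝕜 := ℂ))

theorem coeff_coe (n : ℕ) (D : DirichletPoly lam p) :
    coeff lam p n (D : HardySpace lam p) = DirichletPoly.coeffₗ lam p n D :=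
  ContinuousLinearMap.extend_eq (DirichletPoly.coeffL lam p n)
    (e := UniformSpace.Completion.toComplL (𝕜 := ℂ))
    UniformSpace.Completion.denseRange_coe
    (UniformSpace.Completion.isUniformInducing_coe _) D

/-- The canonical basis and the coefficient functionals are biorthogonal. -/
theorem coeff_basis (m n : ℕ) : coeff lam p m (basis lam p n) = if n = m then 1 else 0 := by
  rw [basis, coeff_coe]
  exact Finsupp.single_apply

end HardySpace

/-! ### Greedy-type properties of a basis `x` with dual basis `x'` -/

section Greedy

variable {X : Type*} [NormedAddCommGroup X] [NormedSpace ℂ X]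

/-- The coordinate projection `P_A(f) = ∑_{j ∈ A} x'_j(f) x_j`. -/
def coordProj (x : ℕ → X) (x' : ℕ → X →L[ℂ] ℂ) (A : Finset ℕ) (f : X) : X :=
  ∑ j ∈ A, x' j f • x j

/-- `A` is a greedy set of `f`. -/
def IsGreedySet (x' : ℕ → X →L[ℂ] ℂ) (f : X) (A : Finset ℕ) : Prop :=
  ∀ j ∈ A, ∀ k ∉ A, ‖x' k f‖ ≤ ‖x' j f‖

/-- Greedy bases: projections on greedy sets are, up to a constant, best `m`-term
approximations. -/
def IsGreedyBasis (x : ℕ → X) (x' : ℕ → X →L[ℂ] ℂ) : Prop :=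
  ∃ C : ℝ, ∀ (f : X) (A : Finset ℕ), IsGreedySet x' f A →
    ∀ (B : Finset ℕ), B.card ≤ A.card → ∀ b : ℕ → ℂ,
      ‖f - coordProj x x' A f‖ ≤ C * ‖f - ∑ n ∈ B, b n • x n‖

/-- Almost greedy bases: projections on greedy sets are, up to a constant, best among
coordinate projections on sets of at most the same cardinality. -/
def IsAlmostGreedyBasis (x : ℕ → X) (x' : ℕ → X →L[ℂ] ℂ) : Prop :=
  ∃ C : ℝ, ∀ (f : X) (A : Finset ℕ), IsGreedySet x' f A →
    ∀ (B : Finset ℕ), B.card ≤ A.card →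
      ‖f - coordProj x x' A f‖ ≤ C * ‖f - coordProj x x' B f‖

/-- Semi-greedy bases: for every greedy set `A` of `f`, a best approximation to `f` from the span
of `{x_n : n ∈ A}` (a Chebyshev greedy approximant) is, up to a constant, a best `m`-term
approximation. -/
def IsSemiGreedyBasis (x : ℕ → X) (x' : ℕ → X →L[ℂ] ℂ) : Prop :=
  ∃ C : ℝ, ∀ (f : X) (A : Finset ℕ), IsGreedySet x' f A →
    ∃ a : ℕ → ℂ,
      (∀ c : ℕ → ℂ, ‖f - ∑ n ∈ A, a n • x n‖ ≤ ‖f - ∑ n ∈ A, c n • x n‖) ∧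
      ∀ (B : Finset ℕ), B.card ≤ A.card → ∀ b : ℕ → ℂ,
        ‖f - ∑ n ∈ A, a n • x n‖ ≤ C * ‖f - ∑ n ∈ B, b n • x n‖

/-- Quasi-greedy bases: projections on greedy sets are uniformly bounded. -/
def IsQuasiGreedyBasis (x : ℕ → X) (x' : ℕ → X →L[ℂ] ℂ) : Prop :=
  ∃ C : ℝ, ∀ (f : X) (A : Finset ℕ), IsGreedySet x' f A → ‖coordProj x x' A f‖ ≤ C * ‖f‖

/-- Nearly unconditional bases, in the sense of Elton. -/
def IsNearlyUnconditional (x : ℕ → X) (x' : ℕ → X →L[ℂ] ℂ) : Prop :=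
  ∀ τ : ℝ, 0 < τ → τ ≤ 1 → ∃ C : ℝ, ∀ f : X, (∀ n, ‖x' n f‖ ≤ 1) →
    ∀ A : Finset ℕ, (∀ n ∈ A, τ ≤ ‖x' n f‖) → ‖coordProj x x' A f‖ ≤ C * ‖f‖

/-- Quasi-greedy bases for largest coefficients. -/
def IsQuasiGreedyLargestCoeff (x : ℕ → X) (x' : ℕ → X →L[ℂ] ℂ) : Prop :=
  ∃ C : ℝ, ∀ (A : Finset ℕ) (ε : ℕ → ℂ), (∀ n ∈ A, ‖ε n‖ = 1) →
    ∀ f : X, (∀ n, ‖x' n f‖ ≤ 1) → (∀ n ∈ A, x' n f = 0) →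
      ‖∑ n ∈ A, ε n • x n‖ ≤ C * ‖(∑ n ∈ A, ε n • x n) + f‖

/-- Bases that are suppression unconditional for constant coefficients. -/
def IsSUCC (x : ℕ → X) : Prop :=
  ∃ C : ℝ, ∀ (A B : Finset ℕ), A ⊆ B → ∀ ε δ : ℕ → ℂ,
    (∀ n ∈ A, ‖ε n‖ = 1) → (∀ n ∈ B, ‖δ n‖ = 1) →
      ‖∑ n ∈ A, ε n • x n‖ ≤ C * ‖∑ n ∈ B, δ n • x n‖

end Greedy

end

/-! For p = 2 the monomials are orthonormal: Parseval's identity gives exact formulas for all the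
distances involved, and the positive statements hold with constant 1, or follow from those that do.
For p ≠ 2 the obstruction lives on arithmetic progressions. There a Dirichlet polynomial has the
norm of a trigonometric polynomial on the circle with the same coefficients (`norm_onIndices`,
`norm_onIndices_top`), so long progressions carry all of classical L^p of the circle. Two choices of
signs on t⁴ consecutive frequencies are compared: the Dirichlet kernel, which is peaked, and a
Rudin–Shapiro polynomial, which is flat with supremum at most 2t². Both have L² norm t². The L¹ norm
of the kernel is at most 11t, and interpolation makes its q-th moment at most a constant times
t^(3q-2) for q < 2 and at least a constant times t^(3q-2) for q > 2, whereas the q-th moment of the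
flat polynomial has order t^(2q). The ratio is unbounded unless q = 2, and p = ∞ is similar
(`ExpSum.exists_signs`). Hence changes of signs are not uniformly bounded. This contradicts property
7 at once, and property 6 because suppression of terms controls sign changes; properties 1, 2, 4 and
5 all imply 6. For property 3, the two sign choices are placed on the even and the odd terms of one
progression, and the projection onto the odd terms is contractive whatever the coefficients on the
even terms are. -/

noncomputable section

/-! ### Parseval's identity for Dirichlet polynomials. -/

namespace DirichletPoly

/-- Parseval's identity for Dirichlet polynomials. -/
theorem norm_sq_eq_sum (lam : Frequency) (D : DirichletPoly lam 2) :
    ‖D‖ ^ 2 = ∑ n ∈ Finsupp.support (show ℕ →₀ ℂ from D), ‖coeffₗ lam 2 n D‖ ^ 2 := by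
  set S := Finsupp.support (show ℕ →₀ ℂ from D) with hS
  have h1 : Tendsto (fun R : ℝ => ∑ n ∈ S, (starRingEnd ℂ (coeffₗ lam 2 n D)) *
      (((1 / (2 * R) : ℝ) : ℂ) * ∫ t in (-R)..R,
        evalIm D t * expHom (Multiplicative.ofAdd (lam.seq n)) t)) atTop
      (𝓝 (∑ n ∈ S, (starRingEnd ℂ (coeffₗ lam 2 n D)) * coeffₗ lam 2 n D)) :=
    tendsto_finsetSum _ fun n _ => (hasMean_coeff D n).2.const_mul _
  have h2 : ∀ R : ℝ, ∑ n ∈ S, (starRingEnd ℂ (coeffₗ lam 2 n D)) *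
      (((1 / (2 * R) : ℝ) : ℂ) * ∫ t in (-R)..R,
        evalIm D t * expHom (Multiplicative.ofAdd (lam.seq n)) t) =
      ((1 / (2 * R) * ∫ t in (-R)..R, ‖evalIm D t‖ ^ (2 : ℝ) : ℝ) : ℂ) := by
    intro R
    -- Only the conjugate factor of D · conj D is expanded, so that every summand is one whose mean
    -- `hasMean_coeff` evaluates.
    have e : ∀ t, ((‖evalIm D t‖ ^ (2 : ℝ) : ℝ) : ℂ) = ∑ n ∈ S, (starRingEnd ℂ (coeffₗ lam 2 n D)) *
        (evalIm D t * expHom (Multiplicative.ofAdd (lam.seq n)) t) := by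
      intro t
      have hc : starRingEnd ℂ (evalIm D t) = ∑ n ∈ S, (starRingEnd ℂ (coeffₗ lam 2 n D)) *
          expHom (Multiplicative.ofAdd (lam.seq n)) t := by
        simp [evalIm, Finsupp.sum, expHom, ← Complex.exp_conj, coeffₗ, hS]
        rfl
      rw [Real.rpow_two, ← Complex.normSq_eq_norm_sq, ← Complex.mul_conj, hc, Finset.mul_sum]
      exact Finset.sum_congr rfl fun n _ => by ring
    rw [Complex.ofReal_mul, ← intervalIntegral.integral_ofReal]
    simp only [e]
    rw [intervalIntegral.integral_finsetSum]
    · simp only [intervalIntegral.integral_const_mul, Finset.mul_sum]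
      exact Finset.sum_congr rfl fun n _ => by ring
    · exact fun n _ => ((hasMean_coeff D n).1.const_mul _).intervalIntegrable _ _
  have h3 : Tendsto (fun R : ℝ => 1 / (2 * R) * ∫ t in (-R)..R, ‖evalIm D t‖ ^ (2 : ℝ)) atTop
      (𝓝 (∑ n ∈ S, ‖coeffₗ lam 2 n D‖ ^ 2)) := by
    have := (Complex.continuous_re.tendsto _).comp h1
    simp only [Function.comp_def, h2, Complex.ofReal_re] at this
    convert this using 2
    simp [← Complex.normSq_eq_conj_mul_self, ← Complex.normSq_eq_norm_sq]
  have h4 := (tendsto_pMean (by simp) D).pow 2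
  refine tendsto_nhds_unique h4 (h3.congr' ?_)
  filter_upwards [eventually_gt_atTop 0] with R hR
  have : 0 ≤ 1 / (2 * R) * ∫ t in (-R)..R, ‖evalIm D t‖ ^ (2 : ℝ) :=
    mul_nonneg (by positivity) (intervalIntegral.integral_nonneg (by linarith)
      fun t _ => by positivity)
  simp only [pMean, ENNReal.toReal_ofNat]
  rw [← Real.sqrt_eq_rpow, Real.sq_sqrt this]

theorem norm_sq_eq_sum_of_subset (lam : Frequency) (D : DirichletPoly lam 2) {S : Finset ℕ}
    (hS : ∀ n ∉ S, coeffₗ lam 2 n D = 0) :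
    ‖D‖ ^ 2 = ∑ n ∈ S, ‖coeffₗ lam 2 n D‖ ^ 2 := by
  rw [norm_sq_eq_sum]
  refine Finset.sum_subset (fun n hn => ?_) fun n _ hn => ?_
  · by_contra h
    exact (Finsupp.mem_support_iff.1 hn) (hS n h)
  · have : coeffₗ lam 2 n D = 0 := Finsupp.notMem_support_iff.1 hn
    simp [this]

theorem coeffₗ_monomial (lam : Frequency) (p : ℝ≥0∞) (m n : ℕ) :
    coeffₗ lam p m (monomial lam p n) = if n = m then 1 else 0 :=
  Finsupp.single_apply

theorem coeffₗ_sum (lam : Frequency) (p : ℝ≥0∞) (B : Finset ℕ) (b : ℕ → ℂ) (m : ℕ) :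
    coeffₗ lam p m (∑ n ∈ B, b n • monomial lam p n) = if m ∈ B then b m else 0 := by
  simp [map_sum, coeffₗ_monomial]

/-- By orthogonality the subtraction changes only the terms of Parseval's sum indexed by `B`. The
best choice of `b` is therefore visible at once. -/
theorem norm_sub_sum_sq (lam : Frequency) (D : DirichletPoly lam 2) (B : Finset ℕ) (b : ℕ → ℂ) :
    ‖D - ∑ n ∈ B, b n • monomial lam 2 n‖ ^ 2 = ‖D‖ ^ 2 - ∑ n ∈ B, ‖coeffₗ lam 2 n D‖ ^ 2
      + ∑ n ∈ B, ‖coeffₗ lam 2 n D - b n‖ ^ 2 := by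
  classical
  set S := Finsupp.support (show ℕ →₀ ℂ from D) ∪ B with hS
  have h0 : ∀ n ∉ S, coeffₗ lam 2 n D = 0 := fun n hn =>
    Finsupp.notMem_support_iff.1 fun h => hn (Finset.mem_union_left _ h)
  have hB : B ⊆ S := Finset.subset_union_right
  rw [norm_sq_eq_sum_of_subset lam D h0, norm_sq_eq_sum_of_subset lam (S := S)]
  · rw [← Finset.sum_sdiff hB, ← Finset.sum_sdiff hB (f := fun n => ‖coeffₗ lam 2 n D‖ ^ 2),
      add_sub_cancel_right]
    congr 1
    · refine Finset.sum_congr rfl fun n hn => ?_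
      rw [map_sub, coeffₗ_sum, if_neg (Finset.mem_sdiff.1 hn).2, sub_zero]
    · refine Finset.sum_congr rfl fun n hn => ?_
      rw [map_sub, coeffₗ_sum, if_pos hn]
  · intro n hn
    rw [map_sub, coeffₗ_sum, if_neg fun h => hn (hB h), h0 n hn, sub_zero]

end DirichletPoly

/-! ### The case p = 2 in the completion. -/

namespace HardySpace

theorem coe_sum_monomial (lam : Frequency) (p : ℝ≥0∞) [Fact (1 ≤ p)] {ι : Type*} (B : Finset ι)
    (b : ι → ℂ) (i : ι → ℕ) :
    ((∑ n ∈ B, b n • DirichletPoly.monomial lam p (i n) : DirichletPoly lam p) : HardySpace lam p)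
      = ∑ n ∈ B, b n • basis lam p (i n) := by
  have h := map_sum (UniformSpace.Completion.toComplL (𝕜 := ℂ) (E := DirichletPoly lam p))
    (fun n => b n • DirichletPoly.monomial lam p (i n)) B
  exact h.trans (Finset.sum_congr rfl fun n _ =>
    map_smul (UniformSpace.Completion.toComplL (𝕜 := ℂ) (E := DirichletPoly lam p)) (b n) _)

/-- `B` is finite, so both sides are continuous in `f` and density of the polynomials suffices.
Bessel's inequality, best approximation and Parseval for finite sums are all read off from this
identity. -/
theorem norm_sub_sum_sq (lam : Frequency) (f : HardySpace lam 2) (B : Finset ℕ) (b : ℕ → ℂ) :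
    ‖f - ∑ n ∈ B, b n • basis lam 2 n‖ ^ 2 = ‖f‖ ^ 2 - ∑ n ∈ B, ‖coeff lam 2 n f‖ ^ 2
      + ∑ n ∈ B, ‖coeff lam 2 n f - b n‖ ^ 2 := by
  induction f using UniformSpace.Completion.induction_on with
  | hp => exact isClosed_eq (by fun_prop) (by fun_prop)
  | ih D =>
    simp only [coeff_coe]
    rw [← coe_sum_monomial lam 2 B b fun n => n, ← UniformSpace.Completion.coe_sub,
      UniformSpace.Completion.norm_coe, UniformSpace.Completion.norm_coe,
      DirichletPoly.norm_sub_sum_sq]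

theorem norm_sum_sq (lam : Frequency) (B : Finset ℕ) (b : ℕ → ℂ) :
    ‖∑ n ∈ B, b n • basis lam 2 n‖ ^ 2 = ∑ n ∈ B, ‖b n‖ ^ 2 := by
  simpa using norm_sub_sum_sq lam 0 B b

theorem norm_sub_coordProj_sq (lam : Frequency) (f : HardySpace lam 2) (A : Finset ℕ) :
    ‖f - coordProj (basis lam 2) (coeff lam 2) A f‖ ^ 2
      = ‖f‖ ^ 2 - ∑ n ∈ A, ‖coeff lam 2 n f‖ ^ 2 := by
  rw [coordProj, norm_sub_sum_sq lam f A fun n => coeff lam 2 n f]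
  simp

theorem norm_coordProj_le (lam : Frequency) (f : HardySpace lam 2) (A : Finset ℕ) :
    ‖coordProj (basis lam 2) (coeff lam 2) A f‖ ≤ ‖f‖ := by
  refine (sq_le_sq₀ (norm_nonneg _) (norm_nonneg _)).1 ?_
  have := norm_sub_coordProj_sq lam f A
  rw [coordProj, norm_sum_sq]
  linarith [sq_nonneg ‖f - coordProj (basis lam 2) (coeff lam 2) A f‖]

/-- A greedy set carries at least as much of the square sum as any set which is not larger. -/
theorem sum_sq_le_of_isGreedySet {X : Type*} [NormedAddCommGroup X] [NormedSpace ℂ X]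
    {x' : ℕ → X →L[ℂ] ℂ} {f : X} {A B : Finset ℕ} (hA : IsGreedySet x' f A)
    (hB : B.card ≤ A.card) : ∑ n ∈ B, ‖x' n f‖ ^ 2 ≤ ∑ n ∈ A, ‖x' n f‖ ^ 2 := by
  classical
  rw [← Finset.sum_inter_add_sum_sdiff B A, ← Finset.sum_inter_add_sum_sdiff A B,
    Finset.inter_comm]
  refine add_le_add_right ?_ _
  have hc : (B \ A).card ≤ (A \ B).card := by
    have h1 := Finset.card_sdiff_add_card_inter B A
    have h2 := Finset.card_sdiff_add_card_inter A B
    rw [Finset.inter_comm] at h2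
    omega
  rcases (A \ B).eq_empty_or_nonempty with h | h
  · rw [h, Finset.card_empty, Nat.le_zero, Finset.card_eq_zero] at hc
    simp [h, hc]
  -- Once A ∩ B is cancelled, the smallest coefficient on A \ B separates the two sums: it dominates
  -- each term on B \ A, and there are no more of those.
  · obtain ⟨j, hj, hmin⟩ := (A \ B).exists_min_image (fun n => ‖x' n f‖ ^ 2) h
    calc ∑ n ∈ B \ A, ‖x' n f‖ ^ 2 ≤ (B \ A).card • ‖x' j f‖ ^ 2 :=
          Finset.sum_le_card_nsmul _ _ _ fun k hk => by
            gcongr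
            exact hA j (Finset.mem_sdiff.1 hj).1 k (Finset.mem_sdiff.1 hk).2
      _ ≤ (A \ B).card • ‖x' j f‖ ^ 2 := nsmul_le_nsmul_left (sq_nonneg _) hc
      _ ≤ ∑ n ∈ A \ B, ‖x' n f‖ ^ 2 := Finset.card_nsmul_le_sum _ _ _ hmin

theorem norm_sub_coordProj_le (lam : Frequency) {f : HardySpace lam 2} {A B : Finset ℕ}
    (hA : IsGreedySet (coeff lam 2) f A) (hB : B.card ≤ A.card) (b : ℕ → ℂ) :
    ‖f - coordProj (basis lam 2) (coeff lam 2) A f‖ ≤ ‖f - ∑ n ∈ B, b n • basis lam 2 n‖ := by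
  refine (sq_le_sq₀ (norm_nonneg _) (norm_nonneg _)).1 ?_
  rw [norm_sub_coordProj_sq, norm_sub_sum_sq]
  have h1 := sum_sq_le_of_isGreedySet hA hB
  have h2 : 0 ≤ ∑ n ∈ B, ‖coeff lam 2 n f - b n‖ ^ 2 := by positivity
  linarith

theorem isGreedyBasis_two (lam : Frequency) : IsGreedyBasis (basis lam 2) (coeff lam 2) :=
  ⟨1, fun _ _ hA _ hB b => by simpa using norm_sub_coordProj_le lam hA hB b⟩

theorem isSemiGreedyBasis_two (lam : Frequency) :
    IsSemiGreedyBasis (basis lam 2) (coeff lam 2) :=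
  ⟨1, fun f A hA => ⟨fun n => coeff lam 2 n f, fun c => by
    refine (sq_le_sq₀ (norm_nonneg _) (norm_nonneg _)).1 ?_
    simp only [norm_sub_sum_sq, sub_self, norm_zero]
    have : 0 ≤ ∑ n ∈ A, ‖coeff lam 2 n f - c n‖ ^ 2 := by positivity
    simpa using this, fun _ hB b => by simpa [coordProj] using norm_sub_coordProj_le lam hA hB b⟩⟩

theorem isNearlyUnconditional_two (lam : Frequency) :
    IsNearlyUnconditional (basis lam 2) (coeff lam 2) :=
  fun _ _ _ => ⟨1, fun f _ A _ => by simpa using norm_coordProj_le lam f A⟩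

theorem isSUCC_two (lam : Frequency) : IsSUCC (basis lam 2) :=
  ⟨1, fun A B hAB ε δ hε hδ => by
    rw [one_mul]
    refine (sq_le_sq₀ (norm_nonneg _) (norm_nonneg _)).1 ?_
    rw [norm_sum_sq, norm_sum_sq, Finset.sum_congr rfl fun n hn => by rw [hε n hn],
      Finset.sum_congr (s₁ := B) rfl fun n hn => by rw [hδ n hn]]
    simpa using Finset.card_le_card hAB⟩

end HardySpace

/-! ### Implications between the properties for a general biorthogonal system. -/

section Implications

variable {X : Type*} [NormedAddCommGroup X] [NormedSpace ℂ X] {x : ℕ → X} {x' : ℕ → X →L[ℂ] ℂ}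

theorem IsGreedyBasis.isAlmostGreedyBasis (h : IsGreedyBasis x x') : IsAlmostGreedyBasis x x' :=
  h.imp fun _ hC f A hA B hB => hC f A hA B hB fun n => x' n f

theorem IsAlmostGreedyBasis.isQuasiGreedyBasis (h : IsAlmostGreedyBasis x x') :
    IsQuasiGreedyBasis x x' := by
  obtain ⟨C, hC⟩ := h
  refine ⟨1 + C, fun f A hA => ?_⟩
  have h1 := hC f A hA ∅ (by simp)
  have h2 := norm_sub_le f (f - coordProj x x' A f)
  simp only [coordProj, Finset.sum_empty, sub_zero, sub_sub_cancel] at h1 h2 ⊢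
  linarith

theorem coordProj_sum_add (hx : ∀ m n, x' m (x n) = if n = m then 1 else 0) (A : Finset ℕ)
    (ε : ℕ → ℂ) {f : X} (hf : ∀ n ∈ A, x' n f = 0) :
    coordProj x x' A ((∑ n ∈ A, ε n • x n) + f) = ∑ n ∈ A, ε n • x n :=
  Finset.sum_congr rfl fun n hn => by simp [hx, hf n hn, hn]

/-- These bounds make `A` a greedy set of the perturbed sum, and an admissible set for near
unconditionality at threshold 1. -/
theorem norm_coeff_sum_add (hx : ∀ m n, x' m (x n) = if n = m then 1 else 0) {A : Finset ℕ}
    {ε : ℕ → ℂ} (hε : ∀ n ∈ A, ‖ε n‖ = 1) {f : X} (hf : ∀ n ∈ A, x' n f = 0)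
    (hf1 : ∀ n, ‖x' n f‖ ≤ 1) (n : ℕ) :
    ‖x' n ((∑ n ∈ A, ε n • x n) + f)‖ ≤ 1 ∧
      (n ∈ A → ‖x' n ((∑ n ∈ A, ε n • x n) + f)‖ = 1) := by
  by_cases hn : n ∈ A
  · simp [hx, hn, hε n hn, hf n hn]
  · simpa [hx, hn] using hf1 n

theorem IsQuasiGreedyBasis.isQuasiGreedyLargestCoeff
    (hx : ∀ m n, x' m (x n) = if n = m then 1 else 0) (h : IsQuasiGreedyBasis x x') :
    IsQuasiGreedyLargestCoeff x x' :=
  h.imp fun C hC A ε hε f hf1 hf => by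
    have := hC ((∑ n ∈ A, ε n • x n) + f) A fun j hj k _ => by
      rw [(norm_coeff_sum_add hx hε hf hf1 j).2 hj]
      exact (norm_coeff_sum_add hx hε hf hf1 k).1
    rwa [coordProj_sum_add hx A ε hf] at this

theorem IsNearlyUnconditional.isQuasiGreedyLargestCoeff
    (hx : ∀ m n, x' m (x n) = if n = m then 1 else 0) (h : IsNearlyUnconditional x x') :
    IsQuasiGreedyLargestCoeff x x' :=
  (h 1 one_pos le_rfl).imp fun C hC A ε hε f hf1 hf => by
    have := hC ((∑ n ∈ A, ε n • x n) + f) (fun n => (norm_coeff_sum_add hx hε hf hf1 n).1) A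
      fun n hn => ((norm_coeff_sum_add hx hε hf hf1 n).2 hn).ge
    rwa [coordProj_sum_add hx A ε hf] at this

/-- Changes of signs `±1` are bounded on sums of basis vectors if the basis is quasi-greedy for
largest coefficients. -/
theorem IsQuasiGreedyLargestCoeff.exists_norm_sum_le
    (hx : ∀ m n, x' m (x n) = if n = m then 1 else 0) (h : IsQuasiGreedyLargestCoeff x x') :
    ∃ C : ℝ, ∀ (A : Finset ℕ) (ε δ : ℕ → ℂ), (∀ n, ε n = 1 ∨ ε n = -1) →
      (∀ n, δ n = 1 ∨ δ n = -1) → ‖∑ n ∈ A, ε n • x n‖ ≤ C * ‖∑ n ∈ A, δ n • x n‖ := by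
  classical
  obtain ⟨C, hC⟩ := h
  -- The discarded terms are an admissible perturbation `f`, so property 6 bounds the suppression of
  -- any part of a signed sum.
  have key : ∀ (A : Finset ℕ) (q : ℕ → Prop) [DecidablePred q] (δ : ℕ → ℂ), (∀ n, ‖δ n‖ = 1) →
      ‖∑ n ∈ A with q n, δ n • x n‖ ≤ C * ‖∑ n ∈ A, δ n • x n‖ := by
    intro A q _ δ hδ
    have := hC (A.filter q) δ (fun n _ => hδ n) (∑ n ∈ A with ¬ q n, δ n • x n)
      (fun n => by
        simp only [map_sum, map_smul, hx, smul_eq_mul, mul_ite, mul_one, mul_zero,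
          Finset.sum_ite_eq', Finset.mem_filter]
        split_ifs <;> simp [hδ]) fun n hn => by
        simp [hx, (Finset.mem_filter.1 hn).2]
    rwa [Finset.sum_filter_add_sum_filter_not] at this
  refine ⟨C + C, fun A ε δ hε hδ => ?_⟩
  have hδ1 : ∀ n, ‖δ n‖ = 1 := fun n => by rcases hδ n with h | h <;> simp [h]
  -- With real signs, ε = δ or ε = -δ at each index. The two pieces are suppressions of the same
  -- δ-sum, whence the constant C + C.
  have e : ∑ n ∈ A, ε n • x n = ∑ n ∈ A with ε n = δ n, δ n • x n
      - ∑ n ∈ A with ¬ ε n = δ n, δ n • x n := by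
    rw [← Finset.sum_filter_add_sum_filter_not A (fun n => ε n = δ n), sub_eq_add_neg,
      ← Finset.sum_neg_distrib]
    congr 1
    · exact Finset.sum_congr rfl fun n hn => by rw [(Finset.mem_filter.1 hn).2]
    · refine Finset.sum_congr rfl fun n hn => ?_
      have hne := (Finset.mem_filter.1 hn).2
      rw [← neg_smul]
      congr 1
      rcases hε n with h | h <;> rcases hδ n with h' | h' <;> simp_all
  rw [e, add_mul]
  exact (norm_sub_le _ _).trans (add_le_add (key A _ δ hδ1)
    (key A (fun n => ¬ ε n = δ n) δ hδ1))

end Implications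

/-! ### Exponential sums on the circle. -/

/-- The exponential sum `∑_{k < N} c_k e^{-iku}`. -/
def expSum (N : ℕ) (c : ℕ → ℂ) (u : ℝ) : ℂ :=
  ∑ k ∈ Finset.range N, c k * Complex.exp (-(u * Complex.I)) ^ k

theorem norm_exp_neg_mul_I (u : ℝ) : ‖Complex.exp (-(u * Complex.I))‖ = 1 := by
  have := Complex.norm_exp_ofReal_mul_I (-u)
  rwa [Complex.ofReal_neg, neg_mul] at this

theorem continuous_expSum (N : ℕ) (c : ℕ → ℂ) : Continuous (expSum N c) := by
  unfold expSum
  fun_prop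

theorem expSum_periodic (N : ℕ) (c : ℕ → ℂ) : Function.Periodic (expSum N c) (2 * Real.pi) := by
  intro u
  have : Complex.exp (-((u + 2 * Real.pi : ℝ) * Complex.I)) = Complex.exp (-(u * Complex.I)) := by
    rw [Complex.ofReal_add, add_mul, neg_add, ← sub_eq_add_neg]
    push_cast
    exact Complex.exp_periodic.sub_eq _
  simp only [expSum, this]

theorem norm_expSum_periodic (N : ℕ) (c : ℕ → ℂ) (q : ℝ) :
    Function.Periodic (fun u => ‖expSum N c u‖ ^ q) (2 * Real.pi) := fun u => by
  simp only [expSum_periodic N c u]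

/-- A shift by half a period replaces the variable z = e^{-iu} by -z. -/
theorem expSum_add_pi (N : ℕ) (c : ℕ → ℂ) (u : ℝ) :
    expSum N c (u + Real.pi) = expSum N (fun k => (-1) ^ k * c k) u := by
  have : Complex.exp (-((u + Real.pi : ℝ) * Complex.I)) = -1 * Complex.exp (-(u * Complex.I)) := by
    rw [Complex.ofReal_add, add_mul, neg_add, Complex.exp_add, Complex.exp_neg (Real.pi * _),
      Complex.exp_pi_mul_I]
    norm_num
  refine Finset.sum_congr rfl fun k _ => ?_
  rw [this, mul_pow]
  ring

theorem norm_expSum_le (N : ℕ) (c : ℕ → ℂ) (u : ℝ) :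
    ‖expSum N c u‖ ≤ ∑ k ∈ Finset.range N, ‖c k‖ :=
  norm_sum_le_of_le _ fun k _ => by simp [norm_exp_neg_mul_I]

/-! ### Norms along an arithmetic progression. -/

namespace DirichletPoly

/-- The Dirichlet polynomial with coefficients `c₀, …, c_{N-1}` at the indices `i 0, …, i (N-1)`. -/
def onIndices (lam : Frequency) (p : ℝ≥0∞) (i : ℕ → ℕ) (N : ℕ) (c : ℕ → ℂ) :
    DirichletPoly lam p :=
  ∑ k ∈ Finset.range N, c k • monomial lam p (i k)

variable {lam : Frequency} {p : ℝ≥0∞} {i : ℕ → ℕ} {N : ℕ} {a d : ℝ}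

theorem evalIm_monomial (n : ℕ) (t : ℝ) :
    evalIm (monomial lam p n) t = Complex.exp (-(lam.seq n * t * Complex.I)) :=
  (Finsupp.sum_single_index (by simp)).trans (one_mul _)

theorem evalIm_sum {ι : Type*} (S : Finset ι) (D : ι → DirichletPoly lam p) (t : ℝ) :
    evalIm (∑ k ∈ S, D k) t = ∑ k ∈ S, evalIm (D k) t := by
  classical
  induction S using Finset.induction_on with
  | empty => exact Finsupp.sum_zero_index
  | insert k S hk ih => rw [Finset.sum_insert hk, Finset.sum_insert hk, evalIm_add, ih]

/-- The first term `a` contributes a unimodular factor and the difference `d` a dilation of the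
variable. -/
theorem norm_evalIm_onIndices (hi : ∀ k < N, lam.seq (i k) = a + k * d) (c : ℕ → ℂ) (t : ℝ) :
    ‖evalIm (onIndices lam p i N c) t‖ = ‖expSum N c (d * t)‖ := by
  have : evalIm (onIndices lam p i N c) t
      = Complex.exp (-((a * t : ℝ) * Complex.I)) * expSum N c (d * t) := by
    rw [onIndices, evalIm_sum, expSum, Finset.mul_sum]
    refine Finset.sum_congr rfl fun k hk => ?_
    rw [evalIm_smul, evalIm_monomial, hi k (Finset.mem_range.1 hk), mul_left_comm,
      ← Complex.exp_nat_mul, ← Complex.exp_add]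
    congr 2
    push_cast
    ring
  rw [this, norm_mul, norm_exp_neg_mul_I, one_mul]

theorem norm_onIndices (hi : ∀ k < N, lam.seq (i k) = a + k * d) (hd : 0 < d) (hp : p ≠ ∞)
    (c : ℕ → ℂ) : ‖onIndices lam p i N c‖
      = (∫ u, ‖expSum N c u‖ ^ p.toReal ∂(segMeasure Real.pi)) ^ (1 / p.toReal) := by
  set D := onIndices lam p i N c with hD
  -- The limit exists, so a sequence of radii suffices. At radius Jπ/d the dilated window consists
  -- of exactly J periods and the mean does not depend on J; taking J = j + 1 keeps the radius
  -- positive.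
  have hR : Tendsto (fun j : ℕ => ((j + 1 : ℕ) : ℝ) * (Real.pi / d)) atTop atTop :=
    (tendsto_natCast_atTop_atTop.comp (tendsto_add_atTop_nat 1)).atTop_mul_const
      (div_pos Real.pi_pos hd)
  refine tendsto_nhds_unique ((tendsto_pMean hp D).comp hR) (tendsto_const_nhds.congr fun j => ?_)
  have hj : (0 : ℝ) < ((j + 1 : ℕ) : ℝ) := by positivity
  simp only [Function.comp_apply]
  generalize j + 1 = J at hj
  have hint : ∀ t₁ t₂ : ℝ, IntervalIntegrable (fun u => ‖expSum N c u‖ ^ p.toReal) volume t₁ t₂ :=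
    fun t₁ t₂ => Continuous.intervalIntegrable ((continuous_expSum N c).norm.rpow_const
      fun _ => Or.inr ENNReal.toReal_nonneg) _ _
  have h1 := (norm_expSum_periodic N c p.toReal).intervalIntegral_add_zsmul_eq (J : ℤ)
    (-(J * Real.pi)) hint
  have h2 := (norm_expSum_periodic N c p.toReal).intervalIntegral_add_eq (-(J * Real.pi))
    (-Real.pi)
  rw [h2] at h1
  have e1 : -(J * Real.pi) + (J : ℤ) • (2 * Real.pi) = J * Real.pi := by simp; ring
  have e2 : -Real.pi + 2 * Real.pi = Real.pi := by ring
  rw [e1, e2, zsmul_eq_mul, Int.cast_natCast] at h1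
  rw [pMean, integral_segMeasure Real.pi_pos]
  congr 1
  simp only [hD, norm_evalIm_onIndices hi]
  rw [intervalIntegral.integral_comp_mul_left (fun u => ‖expSum N c u‖ ^ p.toReal) hd.ne']
  have e3 : d * (J * (Real.pi / d)) = J * Real.pi := by field_simp
  rw [mul_neg, e3, h1, smul_eq_mul, smul_eq_mul]
  field_simp

theorem norm_onIndices_top (hi : ∀ k < N, lam.seq (i k) = a + k * d) (hd : 0 < d)
    (c : ℕ → ℂ) : ‖onIndices lam ∞ i N c‖ = ⨆ u, ‖expSum N c u‖ := by
  rw [norm_def, if_pos rfl]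
  simp only [norm_evalIm_onIndices hi]
  exact (mul_left_surjective₀ hd.ne').iSup_comp fun u => ‖expSum N c u‖

/-- The norm of a Dirichlet polynomial on an arithmetic progression depends only on the
coefficients. -/
theorem norm_onIndices_congr {i' : ℕ → ℕ} {a' d' : ℝ} (hi : ∀ k < N, lam.seq (i k) = a + k * d)
    (hd : 0 < d) (hi' : ∀ k < N, lam.seq (i' k) = a' + k * d') (hd' : 0 < d') (c : ℕ → ℂ) :
    ‖onIndices lam p i N c‖ = ‖onIndices lam p i' N c‖ := by
  by_cases hp : p = ∞
  · subst hp
    rw [norm_onIndices_top hi hd, norm_onIndices_top hi' hd']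
  · rw [norm_onIndices hi hd hp, norm_onIndices hi' hd' hp]

/-- Alternating the signs is a translation by half a period, which changes neither the supremum nor
the mean over a period. -/
theorem norm_onIndices_neg_one_pow (hi : ∀ k < N, lam.seq (i k) = a + k * d) (hd : 0 < d)
    (c : ℕ → ℂ) :
    ‖onIndices lam p i N fun k => (-1) ^ k * c k‖ = ‖onIndices lam p i N c‖ := by
  by_cases hp : p = ∞
  · subst hp
    rw [norm_onIndices_top hi hd, norm_onIndices_top hi hd]
    simp only [← expSum_add_pi]
    exact (Equiv.addRight Real.pi).iSup_comp (g := fun u => ‖expSum N c u‖)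
  · rw [norm_onIndices hi hd hp, norm_onIndices hi hd hp]
    simp only [← expSum_add_pi, integral_segMeasure Real.pi_pos]
    rw [intervalIntegral.integral_comp_add_right fun u => ‖expSum N c u‖ ^ p.toReal]
    have := (norm_expSum_periodic N c p.toReal).intervalIntegral_add_eq 0 (-Real.pi)
    rw [show -Real.pi + 2 * Real.pi = Real.pi by ring] at this
    rw [← this, neg_add_cancel, zero_add, two_mul]

end DirichletPoly

/-! ### Parseval on the circle and Rudin–Shapiro signs. -/

/-- The frequency of all natural numbers. -/
def natFrequency : Frequency where
  seq n := n
  strictMono := Nat.strictMono_cast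
  nonneg n := n.cast_nonneg
  unbounded := tendsto_natCast_atTop_atTop

/-- The same polynomial with frequencies 0, 1, 2, … has its norm computed twice: as an integral over
the circle and by Parseval's identity above. -/
theorem integral_norm_expSum_sq (N : ℕ) (c : ℕ → ℂ) :
    ∫ u, ‖expSum N c u‖ ^ 2 ∂(DirichletPoly.segMeasure Real.pi)
      = ∑ k ∈ Finset.range N, ‖c k‖ ^ 2 := by
  have h1 := DirichletPoly.norm_onIndices (lam := natFrequency) (p := 2) (i := id) (N := N)
    (a := 0) (d := 1) (fun k _ => by simp [natFrequency]) one_pos (by simp) c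
  have h2 := DirichletPoly.norm_sq_eq_sum_of_subset natFrequency
    (DirichletPoly.onIndices natFrequency 2 id N c) (S := Finset.range N) fun n hn => by
      simp only [DirichletPoly.onIndices, id]
      rw [DirichletPoly.coeffₗ_sum, if_neg hn]
  have h0 : 0 ≤ ∫ u, ‖expSum N c u‖ ^ 2 ∂(DirichletPoly.segMeasure Real.pi) :=
    integral_nonneg fun _ => by positivity
  simp only [ENNReal.toReal_ofNat, Real.rpow_two, ← Real.sqrt_eq_rpow] at h1
  rw [h1, Real.sq_sqrt h0] at h2
  rw [h2]
  refine Finset.sum_congr rfl fun n hn => ?_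
  simp only [DirichletPoly.onIndices, id]
  rw [DirichletPoly.coeffₗ_sum, if_pos hn]

/-- The Rudin–Shapiro construction. -/
theorem exists_rudinShapiro (m : ℕ) : ∃ P Q : ℕ → ℂ, (∀ k, P k = 1 ∨ P k = -1) ∧
    (∀ k, Q k = 1 ∨ Q k = -1) ∧
    ∀ u, ‖expSum (2 ^ m) P u‖ ^ 2 + ‖expSum (2 ^ m) Q u‖ ^ 2 = 2 * 2 ^ m := by
  induction m with
  | zero =>
    refine ⟨fun _ => 1, fun _ => 1, by simp, by simp, fun u => ?_⟩
    simp [expSum]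
    norm_num
  | succ m ih =>
    obtain ⟨P, Q, hP, hQ, h⟩ := ih
    -- Concatenation of coefficients: the new pair is P ± z^(2^m) Q, and the parallelogram law
    -- doubles the constant sum of squares.
    refine ⟨fun k => if k < 2 ^ m then P k else Q (k - 2 ^ m),
      fun k => if k < 2 ^ m then P k else -Q (k - 2 ^ m), fun k => ?_, fun k => ?_, fun u => ?_⟩
    · dsimp only
      split_ifs
      exacts [hP k, hQ _]
    · dsimp only
      split_ifs
      exacts [hP k, by rcases hQ (k - 2 ^ m) with h | h <;> simp [h]]
    · set z := Complex.exp (-(u * Complex.I)) with hz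
      have e1 : expSum (2 ^ (m + 1)) (fun k => if k < 2 ^ m then P k else Q (k - 2 ^ m)) u
          = expSum (2 ^ m) P u + z ^ 2 ^ m * expSum (2 ^ m) Q u := by
        rw [expSum, pow_succ, mul_two, Finset.sum_range_add, expSum, expSum, Finset.mul_sum]
        congr 1
        · exact Finset.sum_congr rfl fun k hk => by rw [if_pos (Finset.mem_range.1 hk)]
        · refine Finset.sum_congr rfl fun k hk => ?_
          rw [if_neg (by omega), add_tsub_cancel_left, pow_add]
          ring
      have e2 : expSum (2 ^ (m + 1)) (fun k => if k < 2 ^ m then P k else -Q (k - 2 ^ m)) u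
          = expSum (2 ^ m) P u - z ^ 2 ^ m * expSum (2 ^ m) Q u := by
        rw [expSum, pow_succ, mul_two, Finset.sum_range_add, expSum, expSum, Finset.mul_sum,
          sub_eq_add_neg, ← Finset.sum_neg_distrib]
        congr 1
        · exact Finset.sum_congr rfl fun k hk => by rw [if_pos (Finset.mem_range.1 hk)]
        · refine Finset.sum_congr rfl fun k hk => ?_
          rw [if_neg (by omega), add_tsub_cancel_left, pow_add]
          ring
      have h3 := parallelogram_law_with_norm ℂ (expSum (2 ^ m) P u) (z ^ 2 ^ m * expSum (2 ^ m) Q u)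
      have h4 : ‖z ^ 2 ^ m * expSum (2 ^ m) Q u‖ = ‖expSum (2 ^ m) Q u‖ := by
        rw [norm_mul, norm_pow, hz, norm_exp_neg_mul_I, one_pow, one_mul]
      rw [h4] at h3
      rw [e1, e2, pow_succ (2 : ℝ) m]
      linarith [h u]

/-! ### Moment inequalities and the L¹ norm of the Dirichlet kernel. -/

namespace ExpSum

open DirichletPoly

theorem integrable_of_continuous {f : ℝ → ℝ} (hf : Continuous f) :
    Integrable f (segMeasure Real.pi) := by
  refine Integrable.smul_measure ?_ ENNReal.ofReal_ne_top
  exact (hf.integrableOn_Icc).mono_set Set.Ioc_subset_Icc_self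

theorem integrable_rpow (N : ℕ) (c : ℕ → ℂ) {q : ℝ} (hq : 0 ≤ q) :
    Integrable (fun u => ‖expSum N c u‖ ^ q) (segMeasure Real.pi) :=
  integrable_of_continuous ((continuous_expSum N c).norm.rpow_const fun _ => Or.inr hq)

/-- Lyapunov's inequality for the means of an exponential sum. -/
theorem integral_rpow_le (N : ℕ) (c : ℕ → ℂ) {x y α β : ℝ} (hx : 0 < x) (hy : 0 < y)
    (hα : 0 ≤ α) (hβ : 0 ≤ β) (hαβ : α + β = 1) :
    ∫ u, ‖expSum N c u‖ ^ (x * α + y * β) ∂(segMeasure Real.pi)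
      ≤ (∫ u, ‖expSum N c u‖ ^ x ∂(segMeasure Real.pi)) ^ α
        * (∫ u, ‖expSum N c u‖ ^ y ∂(segMeasure Real.pi)) ^ β := by
  have hnn : ∀ q : ℝ, 0 ≤ ∫ u, ‖expSum N c u‖ ^ q ∂(segMeasure Real.pi) :=
    fun q => integral_nonneg fun u => by positivity
  have hof : ∀ q : ℝ, 0 ≤ q → ENNReal.ofReal (∫ u, ‖expSum N c u‖ ^ q ∂(segMeasure Real.pi))
      = ∫⁻ u, ENNReal.ofReal (‖expSum N c u‖ ^ q) ∂(segMeasure Real.pi) := fun q hq =>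
    ofReal_integral_eq_lintegral_ofReal (integrable_rpow N c hq)
      (Eventually.of_forall fun u => by positivity)
  rw [← ENNReal.ofReal_le_ofReal_iff (by have := hnn x; have := hnn y; positivity),
    ENNReal.ofReal_mul (Real.rpow_nonneg (hnn x) _), ← ENNReal.ofReal_rpow_of_nonneg (hnn x) hα,
    ← ENNReal.ofReal_rpow_of_nonneg (hnn y) hβ, hof x hx.le, hof y hy.le, hof _ (by positivity)]
  have hmeas : ∀ q : ℝ, 0 ≤ q → AEMeasurable (fun u => ENNReal.ofReal (‖expSum N c u‖ ^ q))
      (segMeasure Real.pi) := fun q hq =>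
    (integrable_rpow N c hq).1.aemeasurable.ennreal_ofReal
  refine le_trans (le_of_eq ?_) (ENNReal.lintegral_mul_norm_pow_le (hmeas x hx.le) (hmeas y hy.le)
    hα hβ hαβ)
  refine lintegral_congr fun u => ?_
  have hu := norm_nonneg (expSum N c u)
  rw [ENNReal.ofReal_rpow_of_nonneg (by positivity) hα,
    ENNReal.ofReal_rpow_of_nonneg (by positivity) hβ, ← ENNReal.ofReal_mul (by positivity),
    ← Real.rpow_mul hu, ← Real.rpow_mul hu, ← Real.rpow_add_of_nonneg hu (by positivity)
    (by positivity)]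

/-- An `L¹` bound for the Dirichlet kernel, weaker than the logarithmic one. -/
theorem integral_norm_dirichletKernel_le {t : ℕ} (ht : 0 < t) :
    ∫ u, ‖expSum (t ^ 4) (fun _ => 1) u‖ ∂(segMeasure Real.pi) ≤ 11 * t := by
  have ht1 : (1 : ℝ) ≤ t := by exact_mod_cast ht
  have ht0 : (0 : ℝ) < t := by linarith
  have := isProb_segMeasure Real.pi_pos
  -- The factor 1/(1 - z) in the kernel is replaced by 1/(1 - rz), whose square mean is at most 1/(1
  -- - r) = t². This r makes each term of the final estimate linear in t.
  set r : ℝ := 1 - 1 / (t : ℝ) ^ 2 with hr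
  have hr0 : 0 ≤ r := by
    rw [hr, sub_nonneg, div_le_one (by positivity)]
    nlinarith
  have hr1 : r < 1 := by
    rw [hr, sub_lt_self_iff]
    positivity
  -- `G` is the geometric series of 1/(1 - rz), truncated late enough that |G (1 - rz)| ≥ 1 - r^K ≥
  -- 1/2.
  obtain ⟨K, hK⟩ := exists_pow_lt_of_lt_one (show (0 : ℝ) < 1 / 2 by norm_num) hr1
  set D := expSum (t ^ 4) fun _ => 1 with hD
  set G := expSum K fun k => (r : ℂ) ^ k with hG
  have point : ∀ u, ‖D u‖ ≤ (t * 8 + 2 / (t : ℝ) ^ 3 * ‖D u‖ ^ 2) + 1 / t * ‖G u‖ ^ 2 := by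
    intro u
    set z := Complex.exp (-(u * Complex.I)) with hz
    have hz1 : ‖z‖ = 1 := norm_exp_neg_mul_I u
    have hDz : D u * (1 - z) = 1 - z ^ t ^ 4 := by
      rw [← geom_sum_mul_neg z]
      simp [hD, expSum, hz]
    have hGz : G u * (1 - r * z) = 1 - (r * z) ^ K := by
      rw [← geom_sum_mul_neg]
      simp [hG, expSum, hz, mul_pow]
    have h1 : ‖D u * (1 - r * z)‖ ≤ ‖D u‖ / t ^ 2 + 2 := by
      -- This is 1 - rz = (1 - r) + r(1 - z), multiplied by the kernel.
      have e : D u * (1 - r * z) = ((1 / (t : ℝ) ^ 2 : ℝ) : ℂ) * D u + r * (1 - z ^ t ^ 4) := by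
        rw [← hDz, hr]
        push_cast
        ring
      rw [e]
      refine (norm_add_le _ _).trans (add_le_add ?_ ?_)
      · rw [norm_mul, Complex.norm_real, Real.norm_of_nonneg (by positivity)]
        exact le_of_eq (by ring)
      · rw [norm_mul, Complex.norm_real, Real.norm_of_nonneg hr0]
        have : ‖1 - z ^ t ^ 4‖ ≤ 2 := by
          refine (norm_sub_le _ _).trans ?_
          rw [norm_pow, hz1, norm_one, one_pow]
          norm_num
        nlinarith [norm_nonneg (1 - z ^ t ^ 4)]
    have h2 : 1 / 2 ≤ ‖G u * (1 - r * z)‖ := by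
      rw [hGz]
      have := norm_sub_norm_le (1 : ℂ) ((r * z) ^ K)
      rw [norm_one, norm_pow, norm_mul, hz1, Complex.norm_real, Real.norm_of_nonneg hr0,
        mul_one] at this
      linarith
    have h3 : ‖D u‖ ≤ 2 * ((‖D u‖ / t ^ 2 + 2) * ‖G u‖) := by
      have e : ‖D u‖ * ‖G u * (1 - r * z)‖ = ‖D u * (1 - r * z)‖ * ‖G u‖ := by
        simp only [norm_mul]
        ring
      have a1 := mul_le_mul_of_nonneg_left h2 (norm_nonneg (D u))
      have a2 := mul_le_mul_of_nonneg_right h1 (norm_nonneg (G u))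
      linarith
    -- Weighted arithmetic–geometric mean inequality. The weights t and 1/t balance the square means
    -- t⁴ of `D` and t² of `G`; the terms 8t, 2t and t then add up to 11t.
    have h4 : 2 * ((‖D u‖ / t ^ 2 + 2) * ‖G u‖)
        ≤ t * (‖D u‖ / t ^ 2 + 2) ^ 2 + 1 / t * ‖G u‖ ^ 2 := by
      have := mul_nonneg (one_div_nonneg.2 ht0.le)
        (sq_nonneg (t * (‖D u‖ / t ^ 2 + 2) - ‖G u‖))
      have e : 1 / (t : ℝ) * (t * (‖D u‖ / t ^ 2 + 2) - ‖G u‖) ^ 2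
          = t * (‖D u‖ / t ^ 2 + 2) ^ 2 + 1 / t * ‖G u‖ ^ 2
            - 2 * ((‖D u‖ / t ^ 2 + 2) * ‖G u‖) := by
        field_simp
        ring
      linarith
    have h5 : t * (‖D u‖ / t ^ 2 + 2) ^ 2 ≤ t * 8 + 2 / (t : ℝ) ^ 3 * ‖D u‖ ^ 2 := by
      have := mul_nonneg ht0.le (sq_nonneg (‖D u‖ / t ^ 2 - 2))
      have e : t * 8 + 2 / (t : ℝ) ^ 3 * ‖D u‖ ^ 2 - t * (‖D u‖ / t ^ 2 + 2) ^ 2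
          = t * (‖D u‖ / t ^ 2 - 2) ^ 2 := by
        field_simp
        ring
      linarith
    linarith
  have cD : Continuous D := continuous_expSum _ _
  have cG : Continuous G := continuous_expSum _ _
  have iD : ∫ u, ‖D u‖ ^ 2 ∂(segMeasure Real.pi) = (t : ℝ) ^ 4 := by
    simp [hD, integral_norm_expSum_sq]
  have iG : ∫ u, ‖G u‖ ^ 2 ∂(segMeasure Real.pi) ≤ (t : ℝ) ^ 2 := by
    rw [hG, integral_norm_expSum_sq]
    calc ∑ k ∈ Finset.range K, ‖(r : ℂ) ^ k‖ ^ 2 ≤ ∑ k ∈ Finset.range K, r ^ k := by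
          refine Finset.sum_le_sum fun k _ => ?_
          rw [norm_pow, Complex.norm_real, Real.norm_of_nonneg hr0]
          exact pow_le_of_le_one (by positivity) (pow_le_one₀ hr0 hr1.le) two_ne_zero
      _ = (1 - r ^ K) * t ^ 2 := by
          rw [← geom_sum_mul_neg, hr]
          field_simp
          ring
      _ ≤ t ^ 2 := by
          have := pow_nonneg hr0 K
          nlinarith [sq_nonneg (t : ℝ)]
  calc ∫ u, ‖D u‖ ∂(segMeasure Real.pi)
      ≤ ∫ u, ((t * 8 + 2 / (t : ℝ) ^ 3 * ‖D u‖ ^ 2) + 1 / t * ‖G u‖ ^ 2) ∂(segMeasure Real.pi) :=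
        integral_mono (integrable_of_continuous (by fun_prop))
          (integrable_of_continuous (by fun_prop)) point
    _ = t * 8 + 2 / (t : ℝ) ^ 3 * t ^ 4
        + 1 / t * ∫ u, ‖G u‖ ^ 2 ∂(segMeasure Real.pi) := by
        rw [integral_add (integrable_of_continuous (by fun_prop))
          (integrable_of_continuous (by fun_prop)), integral_add (integrable_const _)
          (integrable_of_continuous (by fun_prop))]
        simp [integral_const_mul, iD]
    _ ≤ t * 8 + 2 / (t : ℝ) ^ 3 * t ^ 4 + 1 / t * t ^ 2 := by gcongr
    _ = 11 * t := by
        field_simp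
        ring

end ExpSum

/-! ### The Dirichlet kernel against Rudin–Shapiro polynomials. -/

namespace ExpSum

open DirichletPoly

/-- The mean of `|D|^q` for the Dirichlet kernel of order `t⁴`, for `1 ≤ q ≤ 2`. -/
theorem integral_dirichletKernel_rpow_le {t : ℕ} (ht : 0 < t) {q : ℝ} (hq1 : 1 ≤ q)
    (hq2 : q ≤ 2) :
    ∫ u, ‖expSum (t ^ 4) (fun _ => 1) u‖ ^ q ∂(segMeasure Real.pi)
      ≤ 11 ^ (2 - q) * (t : ℝ) ^ (3 * q - 2) := by
  have ht0 : (0 : ℝ) < t := by exact_mod_cast ht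
  -- The exponent q is interpolated between 1 and 2, giving the power (2 - q) + 4(q - 1) = 3q - 2 of
  -- t.
  have h := integral_rpow_le (t ^ 4) (fun _ => 1) (x := 1) (y := 2) (α := 2 - q) (β := q - 1)
    one_pos two_pos (by linarith) (by linarith) (by ring)
  simp only [Real.rpow_one, Real.rpow_two, integral_norm_expSum_sq] at h
  rw [show 1 * (2 - q) + 2 * (q - 1) = q by ring] at h
  refine h.trans ?_
  have h1 := Real.rpow_le_rpow (integral_nonneg fun u => norm_nonneg _)
    (integral_norm_dirichletKernel_le ht) (show 0 ≤ 2 - q by linarith)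
  refine (mul_le_mul_of_nonneg_right h1 (by positivity)).trans (le_of_eq ?_)
  rw [Real.mul_rpow (by norm_num) ht0.le, mul_assoc]
  congr 1
  have : (∑ k ∈ Finset.range (t ^ 4), ‖(1 : ℂ)‖ ^ 2) = (t : ℝ) ^ (4 : ℝ) := by simp
  rw [this, ← Real.rpow_mul ht0.le, ← Real.rpow_add ht0]
  congr 1
  ring

/-- The mean of `|D|^q` for the Dirichlet kernel of order `t⁴`, for `q > 2`. -/
theorem le_integral_dirichletKernel_rpow {t : ℕ} (ht : 0 < t) {q : ℝ} (hq : 2 < q) :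
    (t : ℝ) ^ (3 * q - 2) ≤ 11 ^ (q - 2) *
      ∫ u, ‖expSum (t ^ 4) (fun _ => 1) u‖ ^ q ∂(segMeasure Real.pi) := by
  have ht0 : (0 : ℝ) < t := by exact_mod_cast ht
  have hq1 : 0 < q - 1 := by linarith
  -- Here 2 is interpolated between 1 and q: a small L¹ norm and a known L² norm force a large q-th
  -- moment.
  have h := integral_rpow_le (t ^ 4) (fun _ => 1) (x := 1) (y := q) (α := (q - 2) / (q - 1))
    (β := 1 / (q - 1)) one_pos (by linarith) (div_nonneg (by linarith) hq1.le) (by positivity)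
    (by field_simp; ring)
  have e : 1 * ((q - 2) / (q - 1)) + q * (1 / (q - 1)) = 2 := by field_simp; ring
  simp only [e, Real.rpow_one, Real.rpow_two, integral_norm_expSum_sq] at h
  set J := ∫ u, ‖expSum (t ^ 4) (fun _ => 1) u‖ ^ q ∂(segMeasure Real.pi) with hJ
  have hJ0 : 0 ≤ J := integral_nonneg fun u => by positivity
  have h0 : 0 ≤ ∫ u, ‖expSum (t ^ 4) (fun _ => 1) u‖ ∂(segMeasure Real.pi) :=
    integral_nonneg fun u => norm_nonneg _
  have h1 := Real.rpow_le_rpow h0 (integral_norm_dirichletKernel_le ht)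
    (show 0 ≤ q - 2 by linarith)
  have h2 := Real.rpow_le_rpow (by positivity) h hq1.le
  rw [Real.mul_rpow (by positivity) (by positivity), ← Real.rpow_mul h0, ← Real.rpow_mul hJ0,
    div_mul_cancel₀ _ hq1.ne', div_mul_cancel₀ _ hq1.ne', Real.rpow_one] at h2
  have h3 := h2.trans (mul_le_mul_of_nonneg_right h1 hJ0)
  have h4 : (∑ k ∈ Finset.range (t ^ 4), ‖(1 : ℂ)‖ ^ 2) = (t : ℝ) ^ (4 : ℝ) := by simp
  rw [h4, ← Real.rpow_mul ht0.le, Real.mul_rpow (by norm_num) ht0.le] at h3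
  have h5 : (t : ℝ) ^ (4 * (q - 1)) = (t : ℝ) ^ (q - 2) * (t : ℝ) ^ (3 * q - 2) := by
    rw [← Real.rpow_add ht0]
    congr 1
    ring
  rw [h5] at h3
  refine le_of_mul_le_mul_left (h3.trans (le_of_eq ?_)) (Real.rpow_pos_of_pos ht0 (q - 2))
  ring

/-- With t = 2^m the length is t⁴, as for the kernel, and the bound √2 t² is rounded up to 2t². -/
theorem exists_rudinShapiro_bound (m : ℕ) : ∃ P : ℕ → ℂ, (∀ k, P k = 1 ∨ P k = -1) ∧
    ∀ u, ‖expSum ((2 ^ m) ^ 4) P u‖ ≤ 2 * ((2 ^ m : ℕ) : ℝ) ^ 2 := by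
  obtain ⟨P, Q, hP, -, h⟩ := exists_rudinShapiro (m * 4)
  refine ⟨P, hP, fun u => abs_le_of_sq_le_sq' ?_ (by positivity) |>.2⟩
  have := h u
  rw [pow_mul] at this
  rw [pow_mul] at this
  push_cast
  nlinarith [sq_nonneg ‖expSum ((2 ^ m) ^ 4) Q u‖,
    show (0 : ℝ) ≤ ((2 ^ m) ^ 4) by positivity]

theorem integral_rpow_le_of_bound {N : ℕ} {c : ℕ → ℂ} {B : ℝ} (hB : ∀ u, ‖expSum N c u‖ ≤ B)
    {q : ℝ} (hq : 0 ≤ q) : ∫ u, ‖expSum N c u‖ ^ q ∂(segMeasure Real.pi) ≤ B ^ q := by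
  have := isProb_segMeasure Real.pi_pos
  calc _ ≤ ∫ _, B ^ q ∂(segMeasure Real.pi) :=
        integral_mono (integrable_rpow N c hq) (integrable_const _) fun u =>
          Real.rpow_le_rpow (norm_nonneg _) (hB u) hq
    _ = B ^ q := by simp

/-- Pointwise |F|² ≤ B^(2-q) |F|^q, so a flat polynomial with large L² norm has a large q-th moment
also for q < 2. -/
theorem sum_sq_le_of_bound {N : ℕ} {c : ℕ → ℂ} {B : ℝ} (hB : ∀ u, ‖expSum N c u‖ ≤ B)
    {q : ℝ} (hq : 0 < q) (hq2 : q ≤ 2) : ∑ k ∈ Finset.range N, ‖c k‖ ^ 2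
      ≤ B ^ (2 - q) * ∫ u, ‖expSum N c u‖ ^ q ∂(segMeasure Real.pi) := by
  rw [← integral_norm_expSum_sq, ← integral_const_mul]
  refine integral_mono (integrable_of_continuous ((continuous_expSum N c).norm.pow 2))
    ((integrable_rpow N c hq.le).const_mul _) fun u => ?_
  have hu := norm_nonneg (expSum N c u)
  calc ‖expSum N c u‖ ^ 2 = ‖expSum N c u‖ ^ (2 - q) * ‖expSum N c u‖ ^ q := by
        rw [← Real.rpow_add_of_nonneg hu (by linarith) hq.le, sub_add_cancel, Real.rpow_two]
    _ ≤ _ := by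
        gcongr
        exact hB u

theorem exists_lt_two_pow_rpow {x : ℝ} (hx : 0 < x) (M : ℝ) :
    ∃ m : ℕ, M < ((2 ^ m : ℕ) : ℝ) ^ x := by
  have h : Tendsto (fun m : ℕ => ((2 ^ m : ℕ) : ℝ) ^ x) atTop atTop :=
    (tendsto_rpow_atTop hx).comp
      (tendsto_natCast_atTop_atTop.comp (tendsto_pow_atTop_atTop_of_one_lt one_lt_two))
  exact (h.eventually_gt_atTop M).exists

theorem mul_rpow_inv_lt {C q I J : ℝ} (hC : 0 ≤ C) (hq : 0 < q) (hI : 0 ≤ I)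
    (h : C ^ q * I < J) : C * I ^ (1 / q) < J ^ (1 / q) := by
  have h1 := Real.rpow_lt_rpow (by positivity) h (one_div_pos.2 hq)
  rwa [Real.mul_rpow (by positivity) hI, ← Real.rpow_mul hC, mul_one_div_cancel hq.ne',
    Real.rpow_one] at h1

/-- Two choices of signs on long arithmetic progressions whose norms are not comparable. -/
theorem exists_signs {p : ℝ≥0∞} (hp1 : 1 ≤ p) (hp : p ≠ 2) (C : ℝ) :
    ∃ (N : ℕ) (ε δ : ℕ → ℂ), (∀ k, ε k = 1 ∨ ε k = -1) ∧ (∀ k, δ k = 1 ∨ δ k = -1) ∧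
      ∀ (lam : Frequency) (i : ℕ → ℕ) (a d : ℝ), 0 < d →
        (∀ k < N, lam.seq (i k) = a + k * d) →
        C * ‖onIndices lam p i N ε‖ < ‖onIndices lam p i N δ‖ := by
  wlog hC : 0 ≤ C generalizing C
  · obtain ⟨N, ε, δ, hε, hδ, h⟩ := this |C| (abs_nonneg C)
    refine ⟨N, ε, δ, hε, hδ, fun lam i a d hd hi => lt_of_le_of_lt ?_ (h lam i a d hd hi)⟩
    exact mul_le_mul_of_nonneg_right (le_abs_self C) (norm_nonneg' _)
  by_cases hpt : p = ∞
  · subst hpt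
    -- The kernel takes the value t⁴ at 0 and the flat polynomial stays below 2t², so t² > 2C is
    -- enough.
    obtain ⟨m, hm⟩ := exists_lt_two_pow_rpow two_pos (C * 2)
    obtain ⟨P, hP, hPb⟩ := exists_rudinShapiro_bound m
    refine ⟨(2 ^ m) ^ 4, P, fun _ => 1, hP, by simp, fun lam i a d hd hi => ?_⟩
    rw [norm_onIndices_top hi hd, norm_onIndices_top hi hd]
    have h1 : ((2 ^ m : ℕ) : ℝ) ^ 4 ≤ ⨆ u, ‖expSum ((2 ^ m) ^ 4) (fun _ => 1) u‖ := by
      refine le_trans (le_of_eq ?_) (le_ciSup (f := fun u => ‖expSum ((2 ^ m) ^ 4) (fun _ => 1) u‖)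
        ⟨_, by rintro _ ⟨u, rfl⟩; exact norm_expSum_le _ _ u⟩ 0)
      simp [expSum]
    refine lt_of_lt_of_le ?_ h1
    refine (mul_le_mul_of_nonneg_left (ciSup_le hPb) hC).trans_lt ?_
    rw [Real.rpow_two] at hm
    have : (0 : ℝ) < ((2 ^ m : ℕ) : ℝ) ^ 2 := by positivity
    nlinarith
  set q := p.toReal with hq
  have hq1 : 1 ≤ q := by simpa using ENNReal.toReal_mono hpt hp1
  have hq0 : 0 < q := by linarith
  have hq2 : q ≠ 2 := fun h => hp (by rw [← ENNReal.ofReal_toReal hpt, ← hq, h]; simp)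
  rcases hq2.lt_or_gt with hlt | hgt
  -- For q < 2 the kernel has the smaller norm; the ratio of q-th moments is at least a constant
  -- times t^(2-q).
  · obtain ⟨m, hm⟩ := exists_lt_two_pow_rpow (sub_pos.2 hlt) (C ^ q * 11 ^ (2 - q) * 2 ^ (2 - q))
    obtain ⟨P, hP, hPb⟩ := exists_rudinShapiro_bound m
    refine ⟨(2 ^ m) ^ 4, fun _ => 1, P, by simp, hP, fun lam i a d hd hi => ?_⟩
    rw [norm_onIndices hi hd hpt, norm_onIndices hi hd hpt, ← hq]
    refine mul_rpow_inv_lt hC hq0 (integral_nonneg fun u => by positivity) ?_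
    have h1 := integral_dirichletKernel_rpow_le (pow_pos two_pos m : 0 < 2 ^ m) hq1 hlt.le
    have h2 := sum_sq_le_of_bound hPb hq0 hlt.le
    have h3 : ∑ k ∈ Finset.range ((2 ^ m) ^ 4), ‖P k‖ ^ 2 = ((2 ^ m : ℕ) : ℝ) ^ (4 : ℝ) := by
      rw [Finset.sum_congr rfl fun k _ => show ‖P k‖ ^ 2 = 1 by
        rcases hP k with h | h <;> simp [h]]
      simp
    rw [h3] at h2
    have ht0 : (0 : ℝ) < ((2 ^ m : ℕ) : ℝ) := by positivity
    generalize ((2 ^ m : ℕ) : ℝ) = t at *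
    have h4 : (2 * t ^ 2) ^ (2 - q) = 2 ^ (2 - q) * t ^ (4 - 2 * q) := by
      rw [Real.mul_rpow (by norm_num) (by positivity), ← Real.rpow_two, ← Real.rpow_mul ht0.le]
      congr 2
      ring
    have h5 : t ^ (4 : ℝ) = t ^ (4 - 2 * q) * (t ^ (3 * q - 2) * t ^ (2 - q)) := by
      rw [← Real.rpow_add ht0, ← Real.rpow_add ht0]
      congr 1
      ring
    rw [h4, h5, mul_comm (2 ^ (2 - q) : ℝ), mul_assoc] at h2
    have h6 := le_of_mul_le_mul_left h2 (Real.rpow_pos_of_pos ht0 _)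
    have hE : (0 : ℝ) < 2 ^ (2 - q) := by positivity
    refine lt_of_mul_lt_mul_left (lt_of_lt_of_le ?_ h6) hE.le
    calc _ ≤ 2 ^ (2 - q) * (C ^ q * (11 ^ (2 - q) * t ^ (3 * q - 2))) := by gcongr
      _ = t ^ (3 * q - 2) * (C ^ q * 11 ^ (2 - q) * 2 ^ (2 - q)) := by ring
      _ < t ^ (3 * q - 2) * t ^ (2 - q) := by gcongr
  -- For q > 2 the roles are exchanged and the gain is t^(q-2).
  · obtain ⟨m, hm⟩ := exists_lt_two_pow_rpow (sub_pos.2 hgt) (C ^ q * 11 ^ (q - 2) * 2 ^ q)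
    obtain ⟨P, hP, hPb⟩ := exists_rudinShapiro_bound m
    refine ⟨(2 ^ m) ^ 4, P, fun _ => 1, hP, by simp, fun lam i a d hd hi => ?_⟩
    rw [norm_onIndices hi hd hpt, norm_onIndices hi hd hpt, ← hq]
    refine mul_rpow_inv_lt hC hq0 (integral_nonneg fun u => by positivity) ?_
    have h1 := le_integral_dirichletKernel_rpow (pow_pos two_pos m : 0 < 2 ^ m) hgt
    have h2 := integral_rpow_le_of_bound hPb hq0.le
    have ht0 : (0 : ℝ) < ((2 ^ m : ℕ) : ℝ) := by positivity
    generalize ((2 ^ m : ℕ) : ℝ) = t at *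
    have h4 : (2 * t ^ 2) ^ q = 2 ^ q * t ^ (2 * q) := by
      rw [Real.mul_rpow (by norm_num) (by positivity), ← Real.rpow_two, ← Real.rpow_mul ht0.le]
    have h5 : t ^ (3 * q - 2) = t ^ (2 * q) * t ^ (q - 2) := by
      rw [← Real.rpow_add ht0]
      congr 1
      ring
    rw [h4] at h2
    rw [h5] at h1
    have hE : (0 : ℝ) < 11 ^ (q - 2) := by positivity
    refine lt_of_mul_lt_mul_left (lt_of_lt_of_le ?_ h1) hE.le
    calc _ ≤ 11 ^ (q - 2) * (C ^ q * (2 ^ q * t ^ (2 * q))) := by gcongr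
      _ = t ^ (2 * q) * (C ^ q * 11 ^ (q - 2) * 2 ^ q) := by ring
      _ < t ^ (2 * q) * t ^ (q - 2) := by gcongr

end ExpSum

/-! ### Even and odd terms of a progression. -/

theorem sum_range_two_mul {M : Type*} [AddCommMonoid M] (g : ℕ → M) (N : ℕ) :
    ∑ k ∈ Finset.range (2 * N), g k
      = ∑ k ∈ Finset.range N, g (2 * k) + ∑ k ∈ Finset.range N, g (2 * k + 1) := by
  induction N with
  | zero => simp
  | succ N ih =>
    rw [mul_add, mul_one, Finset.sum_range_succ, Finset.sum_range_succ, ih, Finset.sum_range_succ,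
      Finset.sum_range_succ]
    abel

/-- The terms of odd order of a Dirichlet polynomial on an arithmetic progression are given by a
contractive projection. -/
theorem DirichletPoly.norm_onIndices_odd_le {lam : Frequency} {p : ℝ≥0∞} [Fact (1 ≤ p)]
    {i : ℕ → ℕ} {N : ℕ} {a d : ℝ} (hi : ∀ k < 2 * N, lam.seq (i k) = a + k * d) (hd : 0 < d)
    (v w : ℕ → ℂ) :
    ‖onIndices lam p (fun k => i (2 * k + 1)) N w‖ ≤
      ‖onIndices lam p (fun k => i (2 * k)) N v + onIndices lam p (fun k => i (2 * k + 1)) N w‖ := by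
  set E := onIndices lam p (fun k => i (2 * k)) N v with hE
  set O := onIndices lam p (fun k => i (2 * k + 1)) N w with hO
  set c : ℕ → ℂ := fun k => if k % 2 = 0 then v (k / 2) else w (k / 2) with hc
  have e1 : onIndices lam p i (2 * N) c = E + O := by
    rw [onIndices, sum_range_two_mul]
    have h : ∀ k : ℕ, (2 * k + 1) / 2 = k := fun k => by omega
    simp [hc, hE, hO, onIndices, h]
  -- Alternating signs turn E + O into E - O without changing the norm, and 2O is the difference of
  -- the two.
  have e2 : onIndices lam p i (2 * N) (fun k => (-1) ^ k * c k) = E - O := by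
    rw [onIndices, sum_range_two_mul]
    have h : ∀ k : ℕ, (2 * k + 1) / 2 = k := fun k => by omega
    simp [hc, hE, hO, onIndices, h, pow_succ, pow_mul, sub_eq_add_neg]
  have h1 := norm_onIndices_neg_one_pow (p := p) hi hd c
  rw [e1, e2] at h1
  have h2 : (2 : ℂ) • O = (E + O) - (E - O) := by
    rw [two_smul]
    abel
  have h3 := norm_sub_le (E + O) (E - O)
  rw [← h2, norm_smul, h1, Complex.norm_ofNat] at h3
  linarith

theorem Frequency.HasLongAPs.exists_indices {lam : Frequency} (hlam : lam.HasLongAPs) (N : ℕ) :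
    ∃ (i : ℕ → ℕ) (a d : ℝ), 0 < d ∧ (∀ k < N, lam.seq (i k) = a + k * d) ∧
      Set.InjOn i (Set.Iio N) := by
  obtain ⟨a, d, hd, h⟩ := hlam N
  choose! i hi using h
  refine ⟨i, a, d, hd, hi, fun k hk l hl hkl => ?_⟩
  have h1 := hi k hk
  rw [hkl, hi l hl] at h1
  have h2 : (l : ℝ) * d = k * d := by linarith
  exact_mod_cast (mul_right_cancel₀ hd.ne' h2).symm

/-! ### Failure of the properties for p ≠ 2. -/

namespace HardySpace

variable {lam : Frequency} {p : ℝ≥0∞} [Fact (1 ≤ p)]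

theorem sum_image_basis {i : ℕ → ℕ} {N : ℕ} (hi : Set.InjOn i (Set.Iio N)) {b c : ℕ → ℂ}
    (hbc : ∀ k < N, b (i k) = c k) :
    ∑ n ∈ (Finset.range N).image i, b n • basis lam p n
      = (DirichletPoly.onIndices lam p i N c : HardySpace lam p) := by
  rw [Finset.sum_image (by simpa using hi), DirichletPoly.onIndices, coe_sum_monomial]
  exact Finset.sum_congr rfl fun k hk => by rw [hbc k (Finset.mem_range.1 hk)]

theorem exists_extension {i : ℕ → ℕ} {N : ℕ} (hi : Set.InjOn i (Set.Iio N)) {c : ℕ → ℂ}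
    (hc : ∀ k, c k = 1 ∨ c k = -1) :
    ∃ b : ℕ → ℂ, (∀ n, b n = 1 ∨ b n = -1) ∧ ∀ k < N, b (i k) = c k :=
  -- Off the image of `i` the inverse takes a junk value, but `c` of it is still a sign.
  ⟨fun n => c (Function.invFunOn i (Set.Iio N) n), fun _ => hc _, fun k hk => by
    dsimp only
    rw [hi.leftInvOn_invFunOn hk]⟩

/-- For `p ≠ 2`, changes of signs are unbounded on sums of basis vectors. -/
theorem exists_lt_norm_sum (hlam : lam.HasLongAPs) (hp : p ≠ 2) (C : ℝ) :
    ∃ (A : Finset ℕ) (ε δ : ℕ → ℂ), (∀ n, ε n = 1 ∨ ε n = -1) ∧ (∀ n, δ n = 1 ∨ δ n = -1) ∧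
      C * ‖∑ n ∈ A, ε n • basis lam p n‖ < ‖∑ n ∈ A, δ n • basis lam p n‖ := by
  obtain ⟨N, ε, δ, hε, hδ, h⟩ := ExpSum.exists_signs Fact.out hp C
  obtain ⟨i, a, d, hd, hi, hinj⟩ := hlam.exists_indices N
  obtain ⟨ε', hε', hεi⟩ := exists_extension hinj hε
  obtain ⟨δ', hδ', hδi⟩ := exists_extension hinj hδ
  refine ⟨(Finset.range N).image i, ε', δ', hε', hδ', ?_⟩
  rw [sum_image_basis hinj hεi, sum_image_basis hinj hδi, UniformSpace.Completion.norm_coe,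
    UniformSpace.Completion.norm_coe]
  exact h lam i a d hd hi

theorem eq_two_of_isQuasiGreedyLargestCoeff (hlam : lam.HasLongAPs)
    (h : IsQuasiGreedyLargestCoeff (basis lam p) (coeff lam p)) : p = 2 := by
  by_contra hp
  obtain ⟨C, hC⟩ := h.exists_norm_sum_le (coeff_basis lam p)
  obtain ⟨A, ε, δ, hε, hδ, hlt⟩ := exists_lt_norm_sum hlam hp C
  exact (hC A δ ε hδ hε).not_gt hlt

theorem eq_two_of_isSUCC (hlam : lam.HasLongAPs) (h : IsSUCC (basis lam p)) : p = 2 := by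
  by_contra hp
  obtain ⟨C, hC⟩ := h
  obtain ⟨A, ε, δ, hε, hδ, hlt⟩ := exists_lt_norm_sum hlam hp C
  -- Already the case A = B of property 7 compares arbitrary signs on one set.
  exact (hC A A subset_rfl δ ε (fun n _ => by rcases hδ n with h | h <;> simp [h])
    fun n _ => by rcases hε n with h | h <;> simp [h]).not_gt hlt

/-- Let f be the sum of an ε-signed sum over the even terms `A` and a δ-signed sum over the odd
terms `B`. All nonzero coefficients have modulus 1, so `A` is greedy. Any approximant from `A`
leaves the odd part intact, so the error is at least the norm of the δ-sum; removing the odd part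
instead leaves the ε-sum, and semi-greediness makes the two comparable. -/
theorem eq_two_of_isSemiGreedyBasis (hlam : lam.HasLongAPs)
    (h : IsSemiGreedyBasis (basis lam p) (coeff lam p)) : p = 2 := by
  by_contra hp
  obtain ⟨C, hC⟩ := h
  obtain ⟨N, ε, δ, hε, hδ, hlt⟩ := ExpSum.exists_signs Fact.out hp C
  obtain ⟨i, a, d, hd, hi, hinj⟩ := hlam.exists_indices (2 * N)
  have hinjE : Set.InjOn (fun k => i (2 * k)) (Set.Iio N) := fun k hk l hl hkl => by
    have := hinj (show 2 * k < 2 * N by simp at hk; omega)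
      (show 2 * l < 2 * N by simp at hl; omega) hkl
    omega
  have hinjO : Set.InjOn (fun k => i (2 * k + 1)) (Set.Iio N) := fun k hk l hl hkl => by
    have := hinj (show 2 * k + 1 < 2 * N by simp at hk; omega)
      (show 2 * l + 1 < 2 * N by simp at hl; omega) hkl
    omega
  obtain ⟨ε', hε', hεi⟩ := exists_extension hinjE hε
  obtain ⟨δ', hδ', hδi⟩ := exists_extension hinjO hδ
  set A := (Finset.range N).image fun k => i (2 * k) with hA
  set B := (Finset.range N).image fun k => i (2 * k + 1) with hB
  have hdisj : ∀ n ∈ A, n ∉ B := by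
    intro n hn hn'
    simp only [hA, hB, Finset.mem_image, Finset.mem_range] at hn hn'
    obtain ⟨k, hk, rfl⟩ := hn
    obtain ⟨l, hl, hkl⟩ := hn'
    have := hinj (show 2 * l + 1 < 2 * N by omega) (show 2 * k < 2 * N by omega) hkl
    omega
  have hcard : B.card ≤ A.card := by
    rw [hA, hB, Finset.card_image_of_injOn (by simpa using hinjO),
      Finset.card_image_of_injOn (by simpa using hinjE)]
  have hε1 : ∀ n ∈ A, ‖ε' n‖ = 1 := fun n _ => by rcases hε' n with h | h <;> simp [h]
  have hδ1 : ∀ n, ‖δ' n‖ = 1 := fun n => by rcases hδ' n with h | h <;> simp [h]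
  have hcB : ∀ n, coeff lam p n (∑ m ∈ B, δ' m • basis lam p m) = if n ∈ B then δ' n else 0 :=
    fun n => by simp [coeff_basis]
  have hcoeff := norm_coeff_sum_add (coeff_basis lam p) hε1
    (f := ∑ m ∈ B, δ' m • basis lam p m) (fun n hn => by rw [hcB, if_neg (hdisj n hn)])
    fun n => by rw [hcB]; split_ifs <;> simp [hδ1]
  obtain ⟨b, -, hb⟩ := hC ((∑ n ∈ A, ε' n • basis lam p n) + ∑ m ∈ B, δ' m • basis lam p m) A
    fun j hj k _ => by rw [(hcoeff j).2 hj]; exact (hcoeff k).1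
  have hb' := hb B hcard δ'
  rw [add_sub_cancel_right, add_sub_right_comm, ← Finset.sum_sub_distrib] at hb'
  simp only [← sub_smul] at hb'
  rw [sum_image_basis hinjE hεi, sum_image_basis hinjO hδi,
    sum_image_basis hinjE (b := fun n => ε' n - b n) (c := fun k => ε' (i (2 * k)) - b (i (2 * k)))
      fun _ _ => rfl,
    ← UniformSpace.Completion.coe_add, UniformSpace.Completion.norm_coe,
    UniformSpace.Completion.norm_coe] at hb'
  have h1 := DirichletPoly.norm_onIndices_odd_le (p := p) hi hd
    (fun k => ε' (i (2 * k)) - b (i (2 * k))) δ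
  have hle : ‖DirichletPoly.onIndices lam p (fun k => i (2 * k + 1)) N δ‖
      ≤ C * ‖DirichletPoly.onIndices lam p (fun k => i (2 * k)) N ε‖ := h1.trans hb'
  have hiE : ∀ k < N, lam.seq (i (2 * k)) = a + k * (2 * d) := fun k hk => by
    rw [hi _ (by omega)]
    push_cast
    ring
  have hiO : ∀ k < N, lam.seq (i (2 * k + 1)) = (a + d) + k * (2 * d) := fun k hk => by
    rw [hi _ (by omega)]
    push_cast
    ring
  -- The δ-sum is moved from the odd to the even terms, so that both sign choices sit on one
  -- progression of difference 2d, where `hlt` applies.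
  rw [DirichletPoly.norm_onIndices_congr (i' := fun k => i (2 * k)) hiO (by linarith) hiE
    (by linarith)] at hle
  exact hle.not_gt (hlt lam (fun k => i (2 * k)) a (2 * d) (by linarith) hiE)

end HardySpace

theorem corollary5p2 (lam : Frequency) (hlam : lam.HasLongAPs) (p : ℝ≥0∞) [Fact (1 ≤ p)] :
    (IsGreedyBasis (HardySpace.basis lam p) (HardySpace.coeff lam p) ↔ p = 2) ∧
    (IsAlmostGreedyBasis (HardySpace.basis lam p) (HardySpace.coeff lam p) ↔ p = 2) ∧
    (IsSemiGreedyBasis (HardySpace.basis lam p) (HardySpace.coeff lam p) ↔ p = 2) ∧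
    (IsQuasiGreedyBasis (HardySpace.basis lam p) (HardySpace.coeff lam p) ↔ p = 2) ∧
    (IsNearlyUnconditional (HardySpace.basis lam p) (HardySpace.coeff lam p) ↔ p = 2) ∧
    (IsQuasiGreedyLargestCoeff (HardySpace.basis lam p) (HardySpace.coeff lam p) ↔ p = 2) ∧
    (IsSUCC (HardySpace.basis lam p) ↔ p = 2) := by
  have hx := HardySpace.coeff_basis lam p
  have hQ := HardySpace.eq_two_of_isQuasiGreedyLargestCoeff (p := p) hlam
  refine ⟨⟨fun h => hQ (h.isAlmostGreedyBasis.isQuasiGreedyBasis.isQuasiGreedyLargestCoeff hx),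
      ?_⟩,
    ⟨fun h => hQ (h.isQuasiGreedyBasis.isQuasiGreedyLargestCoeff hx), ?_⟩,
    ⟨HardySpace.eq_two_of_isSemiGreedyBasis hlam, ?_⟩,
    ⟨fun h => hQ (h.isQuasiGreedyLargestCoeff hx), ?_⟩,
    ⟨fun h => hQ (h.isQuasiGreedyLargestCoeff hx), ?_⟩, ⟨hQ, ?_⟩,
    ⟨HardySpace.eq_two_of_isSUCC hlam, ?_⟩⟩ <;> rintro rfl
  · exact HardySpace.isGreedyBasis_two lam
  · exact (HardySpace.isGreedyBasis_two lam).isAlmostGreedyBasis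
  · exact HardySpace.isSemiGreedyBasis_two lam
  · exact (HardySpace.isGreedyBasis_two lam).isAlmostGreedyBasis.isQuasiGreedyBasis
  · exact HardySpace.isNearlyUnconditional_two lam
  · exact (HardySpace.isNearlyUnconditional_two lam).isQuasiGreedyLargestCoeff hx
  · exact HardySpace.isSUCC_two lam

end
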